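/- **Theorem 4.** Let $G_n(\mathbb C^{m+n})$ be the complex Grassmannian of $n$-dimensional subspaces of $\mathbb C^{m+n}$, with its $U(m+n)$-invariant Kähler metric. Let $\mathcal V_0\subset G_n(\mathbb C^{m+n})$ be the set of the points with a Pontrjagin coordinate, where the $n\times m$ complex matrix $Z$ is the coordinate of the subspace spanned by the rows of $(1\,|\,Z)$; the point $0$ has coordinate $Z=0$. Let $\omega$ be the invariant Kähler form, which in these coordinates is $$\omega=\frac i2\,\mathrm{Tr}\bigl[dZ\,(1+Z^+Z)^{-1}\wedge dZ^+\,(1+ZZ^+)^{-1}\bigr],$$ where ${}^+$ is the conjugate transpose. Let $z,z'\in\mathcal V_0$ have Pontrjagin coordinates $Z,Z'$, let $\gamma(0,z,z')$ be a geodesic triangle obtained by joining $0,z,z'$ by geodesic arcs, and let $\sigma(0,z,z')$ be a $C^2$ surface in $G_n(\mathbb C^{m+n})$ spanning it: a $C^2$ map of the square $0\le s,t\le 1$ that sends the edge $s=0$ to the point $0$ and the edges $t=0$, $s=1$, $t=1$ to the arcs from $0$ to $z$, from $z$ to $z'$, and from $0$ to $z'$. Orient $\sigma(0,z,z')$ so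 that its boundary is traversed in the order $0\to z'\to z\to 0$. Then its symplectic area is $$\mathfrak I=\int_{\sigma(0,z,z')}\omega=\frac1{4i}\log\frac{\det(1+ZZ'^+)}{\det(1+Z'Z^+)}$$ in the following sense. 1. $4i\,\mathfrak I$ is a value of the logarithm: $e^{4i\mathfrak I}\det(1+Z'Z^+)=\det(1+ZZ'^+)$. 2. Suppose that $\sigma(0,z,z')$ is swept out by geodesic arcs from $0$ to the points of the side $zz'$ (that is, $s\mapsto\sigma(s,t)$ is a geodesic arc for every $t$), or that it lies in $\mathcal V_0$. Then $\mathfrak I$ is exactly $\frac1{4i}L(1)$, where $L$ is the branch of the logarithm that is obtained by continuation along the side from $z$ to $z'$: there is a continuous $L:[0,1]\to\mathbb C$ with $L(0)=0$ and $e^{L(t)}\det(1+WZ^+)=\det(1+ZW^+)$ for every $t$ for which the point $\sigma(1,t)$ lies in $\mathcal V_0$, $W$ being its Pontrjagin coordinate; and every such $L$ satisfies $\mathfrak I=\frac1{4i}L(1)$. -/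

import Mathlib

open scoped Matrix

noncomputable section

namespace CGrass

/-- The complex Grassmannian of `n`-dimensional subspaces of `ℂ^(n+m)`, realized as the submanifold
of the orthogonal projections of rank `n` inside the real Euclidean space of Hermitian matrices
(with the trace inner product).  Matrices act on row vectors: the projection `P` stands for the
subspace `{v | v ᵥ* P = v}`, i.e. for its row space. -/
def Gr (n m : ℕ) : Set (Matrix (Fin n ⊕ Fin m) (Fin n ⊕ Fin m) ℂ) :=
  {P | P.IsHermitian ∧ P * P = P ∧ P.rank = n}

/-- The `n × (n+m)` matrix `(1 | Z)`, whose rows span the subspace with Pontrjagin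
coordinate `Z`. -/
def frame {n m : ℕ} (Z : Matrix (Fin n) (Fin m) ℂ) : Matrix (Fin n) (Fin n ⊕ Fin m) ℂ :=
  Matrix.fromCols 1 Z

/-- The point of the Grassmannian with Pontrjagin coordinate `Z`: the orthogonal projection onto
the row space of `(1 | Z)`. -/
def point {n m : ℕ} (Z : Matrix (Fin n) (Fin m) ℂ) :
    Matrix (Fin n ⊕ Fin m) (Fin n ⊕ Fin m) ℂ :=
  (frame Z)ᴴ * (frame Z * (frame Z)ᴴ)⁻¹ * frame Z

/-- The domain of the Pontrjagin coordinates: the big cell of the Grassmannian around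
`point 0`. -/
def V0 (n m : ℕ) : Set (Matrix (Fin n ⊕ Fin m) (Fin n ⊕ Fin m) ℂ) :=
  Set.range (point (n := n) (m := m))

/-- The tangent space of the Grassmannian at the projection `P`. -/
def tangent {n m : ℕ} (P : Matrix (Fin n ⊕ Fin m) (Fin n ⊕ Fin m) ℂ) :
    Set (Matrix (Fin n ⊕ Fin m) (Fin n ⊕ Fin m) ℂ) :=
  {X | X.IsHermitian ∧ P * X + X * P = X}

/-- The invariant Kähler form `ω_P(X, Y) = (i/2) Tr (P [X, Y])` of the Grassmannian (a real number
for Hermitian `P`, `X`, `Y`).  In the Pontrjagin coordinates it is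
`(i/2) Tr [dZ (1 + Z⁺Z)⁻¹ ∧ dZ⁺ (1 + ZZ⁺)⁻¹]`, see `kahlerForm_point`. -/
def kahlerForm {n m : ℕ} (P X Y : Matrix (Fin n ⊕ Fin m) (Fin n ⊕ Fin m) ℂ) : ℝ :=
  (Complex.I / 2 * Matrix.trace (P * (X * Y - Y * X))).re

/-- The (entrywise) derivative of a curve of matrices defined on `[0, 1]`. -/
def velocity {a b : Type*} (c : ℝ → Matrix a b ℂ) (t : ℝ) : Matrix a b ℂ :=
  Matrix.of fun i j => derivWithin (fun s => c s i j) (Set.Icc 0 1) t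

/-- `c`, restricted to `[0, 1]`, is a geodesic arc (parametrized proportionally to arc length) of
the Grassmannian: its acceleration in the ambient Euclidean space of Hermitian matrices is
orthogonal to the Grassmannian. -/
structure IsGeodesic (n m : ℕ) (c : ℝ → Matrix (Fin n ⊕ Fin m) (Fin n ⊕ Fin m) ℂ) : Prop where
  mem : ∀ t ∈ Set.Icc (0 : ℝ) 1, c t ∈ Gr n m
  smooth : ∀ i j, ContDiffOn ℝ 2 (fun t => c t i j) (Set.Icc 0 1)
  accel : ∀ t ∈ Set.Icc (0 : ℝ) 1, ∀ X ∈ tangent (c t),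
    Matrix.trace (velocity (velocity c) t * X) = 0

/-- `σ`, restricted to `[0, 1] × [0, 1]`, is a `C²` surface in the Grassmannian spanning a geodesic
triangle with vertices `point 0`, `point Z`, `point Z'`: the edge `s = 0` of the square is mapped to
the vertex `point 0`, and the edges `t = 0`, `s = 1`, `t = 1` to geodesic arcs from `point 0` to
`point Z`, from `point Z` to `point Z'`, and from `point 0` to `point Z'`. -/
structure IsTriangleSurface {n m : ℕ} (Z Z' : Matrix (Fin n) (Fin m) ℂ)
    (σ : ℝ → ℝ → Matrix (Fin n ⊕ Fin m) (Fin n ⊕ Fin m) ℂ) : Prop where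
  mem : ∀ s ∈ Set.Icc (0 : ℝ) 1, ∀ t ∈ Set.Icc (0 : ℝ) 1, σ s t ∈ Gr n m
  smooth : ∀ i j, ContDiffOn ℝ 2 (fun p : ℝ × ℝ => σ p.1 p.2 i j) (Set.Icc 0 1 ×ˢ Set.Icc 0 1)
  apex : ∀ t ∈ Set.Icc (0 : ℝ) 1, σ 0 t = point 0
  vertex : σ 1 0 = point Z
  vertex' : σ 1 1 = point Z'
  side : IsGeodesic n m (fun s => σ s 0)
  side' : IsGeodesic n m (fun s => σ s 1)
  base : IsGeodesic n m (fun t => σ 1 t)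

/-- The symplectic area of `σ`: the integral of `σ^* ω` over the square `[0, 1] × [0, 1]`, oriented
by `dt ∧ ds`, so that the boundary triangle is traversed as `0 → z' → z → 0`. -/
def symplecticArea {n m : ℕ} (σ : ℝ → ℝ → Matrix (Fin n ⊕ Fin m) (Fin n ⊕ Fin m) ℂ) : ℝ :=
  ∫ t in (0 : ℝ)..1, ∫ s in (0 : ℝ)..1,
    kahlerForm (σ s t) (velocity (fun t' => σ s t') t) (velocity (fun s' => σ s' t) s)

/-- `L` is the branch of `log (det (1 + Z W⁺) / det (1 + W Z⁺))` along the arc `c` that starts at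
`point Z` (`W` being the Pontrjagin coordinate of the running point of `c`): it is continuous and
vanishes at the starting point. -/
structure IsLogBranch {n m : ℕ} (Z : Matrix (Fin n) (Fin m) ℂ)
    (c : ℝ → Matrix (Fin n ⊕ Fin m) (Fin n ⊕ Fin m) ℂ) (L : ℝ → ℂ) : Prop where
  cont : ContinuousOn L (Set.Icc 0 1)
  zero : L 0 = 0
  exp_eq : ∀ t ∈ Set.Icc (0 : ℝ) 1, ∀ W : Matrix (Fin n) (Fin m) ℂ, c t = point W →
    Complex.exp (L t) * (1 + W * Zᴴ).det = (1 + Z * Wᴴ).det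

theorem frame_mul_frame {n m : ℕ} (Z W : Matrix (Fin n) (Fin m) ℂ) :
    frame Z * (frame W)ᴴ = 1 + Z * Wᴴ := by
  simp [frame, Matrix.conjTranspose_fromCols_eq_fromRows_conjTranspose,
    Matrix.fromCols_mul_fromRows]

open scoped ComplexOrder in
theorem isUnit_gram {n m : ℕ} (Z : Matrix (Fin n) (Fin m) ℂ) :
    IsUnit (frame Z * (frame Z)ᴴ).det := by
  rw [frame_mul_frame]
  exact ((Matrix.PosDef.one.add_posSemidef
    (Matrix.posSemidef_self_mul_conjTranspose Z)).det_pos.ne').isUnit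

/-- The rows of `(1 | Z)` lie in the subspace that `point Z` stands for. -/
theorem frame_mul_point {n m : ℕ} (Z : Matrix (Fin n) (Fin m) ℂ) :
    frame Z * point Z = frame Z := by
  rw [point, ← Matrix.mul_assoc, ← Matrix.mul_assoc, Matrix.mul_nonsing_inv _ (isUnit_gram Z),
    Matrix.one_mul]

theorem point_mem_Gr {n m : ℕ} (Z : Matrix (Fin n) (Fin m) ℂ) : point Z ∈ Gr n m := by
  refine ⟨?_, ?_, ?_⟩
  · simp [point, Matrix.IsHermitian, Matrix.conjTranspose_mul, Matrix.conjTranspose_nonsing_inv,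
      Matrix.mul_assoc]
  · conv_lhs => lhs; rw [point]
    rw [Matrix.mul_assoc, frame_mul_point, point]
  · apply le_antisymm
    · rw [point]
      refine (Matrix.rank_mul_le_right _ _).trans ?_
      simpa using Matrix.rank_le_card_height (frame Z)
    · have h1 : (frame Z).rank ≤ (point Z).rank := by
        conv_lhs => rw [← frame_mul_point Z]
        exact Matrix.rank_mul_le_right _ _
      have h2 : frame Z * Matrix.fromRows (1 : Matrix (Fin n) (Fin n) ℂ)
          (0 : Matrix (Fin m) (Fin n) ℂ) = 1 := by
        simp [frame, Matrix.fromCols_mul_fromRows]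
      have h3 : (1 : Matrix (Fin n) (Fin n) ℂ).rank ≤ (frame Z).rank := by
        rw [← h2]; exact Matrix.rank_mul_le_left _ _
      simp at h3
      exact h3.trans h1

/-- The derivative of the parametrization `point` at `Z` in the direction `X`. -/
def dpoint {n m : ℕ} (Z X : Matrix (Fin n) (Fin m) ℂ) :
    Matrix (Fin n ⊕ Fin m) (Fin n ⊕ Fin m) ℂ :=
  let N : Matrix (Fin n) (Fin n) ℂ := (frame Z * (frame Z)ᴴ)⁻¹
  let E : Matrix (Fin n) (Fin n ⊕ Fin m) ℂ := Matrix.fromCols 0 X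
  let Q : Matrix (Fin n ⊕ Fin m) (Fin n ⊕ Fin m) ℂ := 1 - point Z
  (frame Z)ᴴ * N * E * Q + Q * Eᴴ * N * frame Z

theorem hasDerivAt_mul {a b c : Type*} [Finite a] [Fintype b] [Finite c]
    {A : ℝ → Matrix a b ℂ} {B : ℝ → Matrix b c ℂ} {A' : Matrix a b ℂ} {B' : Matrix b c ℂ} {t : ℝ}
    (hA : HasDerivAt A A' t) (hB : HasDerivAt B B' t) :
    HasDerivAt (fun s => A s * B s) (A' * B t + A t * B') t := by
  have := Fintype.ofFinite a
  have := Fintype.ofFinite c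
  refine hasDerivAt_pi.2 fun i => hasDerivAt_pi.2 fun j => ?_
  have hA' := fun k => hasDerivAt_pi.1 (hasDerivAt_pi.1 hA i) k
  have hB' := fun k => hasDerivAt_pi.1 (hasDerivAt_pi.1 hB k) j
  have := HasDerivAt.fun_sum (u := Finset.univ) fun k _ => (hA' k).mul (hB' k)
  simpa [Matrix.mul_apply, Finset.sum_add_distrib] using this

theorem hasDerivAt_inv {a : Type*} [Fintype a] [DecidableEq a]
    {A : ℝ → Matrix a a ℂ} {A' : Matrix a a ℂ} {t : ℝ}
    (hA : HasDerivAt A A' t) (hu : ∀ s, IsUnit (A s).det) :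
    HasDerivAt (fun s => (A s)⁻¹) (-((A t)⁻¹ * A' * (A t)⁻¹)) t := by
  have key : ∃ B', HasDerivAt (fun s => (A s)⁻¹) B' t := by
    let := Matrix.linftyOpNormedRing (n := a) (α := ℂ)
    let := Matrix.linftyOpNormedAlgebra (n := a) (α := ℂ) (R := ℝ)
    have h := hasFDerivAt_ringInverse (𝕜 := ℝ) ((Matrix.isUnit_iff_isUnit_det _).2 (hu t)).unit
    have h2 := HasFDerivAt.comp_hasDerivAt t h hA
    simp only [Matrix.nonsing_inv_eq_ringInverse]
    exact ⟨_, h2⟩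
  obtain ⟨B', hB⟩ := key
  have h1 := hasDerivAt_mul hA hB
  have h2 : (fun s => A s * (A s)⁻¹) = fun _ => 1 := by
    funext s; exact Matrix.mul_nonsing_inv _ (hu s)
  rw [h2] at h1
  have h3 : A' * (A t)⁻¹ + A t * B' = 0 := by
    ext i j
    exact (hasDerivAt_pi.1 (hasDerivAt_pi.1 h1 i) j).unique
      (hasDerivAt_const t ((1 : Matrix a a ℂ) i j))
  have h4 : A t * B' = - (A' * (A t)⁻¹) := eq_neg_of_add_eq_zero_right h3
  have h5 : B' = -((A t)⁻¹ * A' * (A t)⁻¹) := by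
    have := congrArg ((A t)⁻¹ * ·) h4
    simpa [← Matrix.mul_assoc, Matrix.nonsing_inv_mul _ (hu t)] using this
  rwa [← h5]

theorem hasDerivAt_point {n m : ℕ} (Z X : Matrix (Fin n) (Fin m) ℂ) :
    HasDerivAt (fun t : ℝ => point (Z + t • X)) (dpoint Z X) 0 := by
  have hF : HasDerivAt (fun t : ℝ => frame (Z + t • X)) (Matrix.fromCols 0 X) 0 := by
    refine hasDerivAt_pi.2 fun i => hasDerivAt_pi.2 fun j => ?_
    rcases j with j | j
    · simpa [frame] using hasDerivAt_const (0 : ℝ) ((1 : Matrix (Fin n) (Fin n) ℂ) i j)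
    · simpa [frame] using
        ((hasDerivAt_id (0 : ℝ)).ofReal_comp.mul_const (X i j)).const_add (Z i j)
  have hFs : HasDerivAt (fun t : ℝ => (frame (Z + t • X))ᴴ) (Matrix.fromCols 0 X)ᴴ 0 :=
    hasDerivAt_pi.2 fun i => hasDerivAt_pi.2 fun j =>
      (hasDerivAt_pi.1 (hasDerivAt_pi.1 hF j) i).star
  have h := hasDerivAt_mul (hasDerivAt_mul hFs (hasDerivAt_inv (hasDerivAt_mul hF hFs)
    fun s => isUnit_gram _)) hF
  have h0 : Z + (0 : ℝ) • X = Z := by simp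
  rw [h0] at h
  refine (congrArg (fun D => HasDerivAt (fun t : ℝ => point (Z + t • X)) D 0) ?_).mp h
  simp only [dpoint, point, Matrix.mul_sub, Matrix.sub_mul, Matrix.mul_add, Matrix.add_mul,
    Matrix.mul_neg, Matrix.neg_mul, Matrix.mul_one, Matrix.one_mul, Matrix.mul_assoc]
  abel

theorem trace_dpoint {n m : ℕ} (Z X Y : Matrix (Fin n) (Fin m) ℂ) :
    Matrix.trace (point Z * (dpoint Z X * dpoint Z Y)) =
      Matrix.trace (X * (1 + Zᴴ * Z)⁻¹ * Yᴴ * (1 + Z * Zᴴ)⁻¹) := by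
  have hN : (1 + Z * Zᴴ) * (1 + Z * Zᴴ)⁻¹ = 1 :=
    Matrix.mul_nonsing_inv _ (frame_mul_frame Z Z ▸ isUnit_gram Z)
  have hinv : (1 + Zᴴ * Z)⁻¹ = 1 - Zᴴ * (1 + Z * Zᴴ)⁻¹ * Z := by
    apply Matrix.inv_eq_right_inv
    have h : Zᴴ * (1 + Z * Zᴴ) * (1 + Z * Zᴴ)⁻¹ * Z = Zᴴ * Z := by
      rw [Matrix.mul_assoc Zᴴ, hN, Matrix.mul_one]
    have h' : Zᴴ * (1 + Z * Zᴴ) = Zᴴ + Zᴴ * Z * Zᴴ := by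
      rw [Matrix.mul_add, Matrix.mul_one, Matrix.mul_assoc]
    rw [h'] at h
    simp only [Matrix.add_mul, Matrix.mul_sub, Matrix.mul_one, Matrix.one_mul,
      Matrix.mul_assoc] at h ⊢
    rw [← h]
    abel
  have hFP := frame_mul_point Z
  obtain ⟨hH, hP, -⟩ := point_mem_Gr Z
  have hPF : point Z * (frame Z)ᴴ = (frame Z)ᴴ := by
    simpa [hH.eq] using congrArg Matrix.conjTranspose hFP
  set Q : Matrix (Fin n ⊕ Fin m) (Fin n ⊕ Fin m) ℂ := 1 - point Z with hQ
  have hPQ : point Z * Q = 0 := by simp [hQ, Matrix.mul_sub, hP]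
  have hQF : Q * (frame Z)ᴴ = 0 := by simp [hQ, Matrix.sub_mul, hPF]
  have hQQ : Q * Q = Q := by
    simp [hQ, Matrix.mul_sub, Matrix.sub_mul, hP]
  have hE : Matrix.fromCols (0 : Matrix (Fin n) (Fin n) ℂ) X * Q
      * (Matrix.fromCols (0 : Matrix (Fin n) (Fin n) ℂ) Y)ᴴ = X * (1 + Zᴴ * Z)⁻¹ * Yᴴ := by
    have h1 : Matrix.fromCols (0 : Matrix (Fin n) (Fin n) ℂ) X * (frame Z)ᴴ = X * Zᴴ := by
      simp [frame, Matrix.conjTranspose_fromCols_eq_fromRows_conjTranspose,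
        Matrix.fromCols_mul_fromRows]
    have h2 : frame Z * (Matrix.fromCols (0 : Matrix (Fin n) (Fin n) ℂ) Y)ᴴ = Z * Yᴴ := by
      simp [frame, Matrix.conjTranspose_fromCols_eq_fromRows_conjTranspose,
        Matrix.fromCols_mul_fromRows]
    have h3 : Matrix.fromCols (0 : Matrix (Fin n) (Fin n) ℂ) X
        * (Matrix.fromCols (0 : Matrix (Fin n) (Fin n) ℂ) Y)ᴴ = X * Yᴴ := by
      simp [Matrix.conjTranspose_fromCols_eq_fromRows_conjTranspose,
        Matrix.fromCols_mul_fromRows]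
    have h4 : Matrix.fromCols (0 : Matrix (Fin n) (Fin n) ℂ) X * point Z
        * (Matrix.fromCols (0 : Matrix (Fin n) (Fin n) ℂ) Y)ᴴ
        = X * Zᴴ * (1 + Z * Zᴴ)⁻¹ * (Z * Yᴴ) := by
      rw [← h1, ← h2, point, frame_mul_frame]
      simp only [Matrix.mul_assoc]
    rw [hinv, hQ, Matrix.mul_sub, Matrix.sub_mul, Matrix.mul_one, h3, h4]
    simp only [Matrix.mul_sub, Matrix.sub_mul, Matrix.mul_one, Matrix.mul_assoc]
  have hprod : point Z * (dpoint Z X * dpoint Z Y) =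
      (frame Z)ᴴ * ((frame Z * (frame Z)ᴴ)⁻¹ * (Matrix.fromCols (0 : Matrix (Fin n) (Fin n) ℂ) X * Q
      * (Matrix.fromCols (0 : Matrix (Fin n) (Fin n) ℂ) Y)ᴴ) * (frame Z * (frame Z)ᴴ)⁻¹ * frame Z) := by
    have e1 : point Z * dpoint Z X = (frame Z)ᴴ * (frame Z * (frame Z)ᴴ)⁻¹
        * Matrix.fromCols (0 : Matrix (Fin n) (Fin n) ℂ) X * Q := by
      simp only [dpoint, Matrix.mul_add, ← Matrix.mul_assoc, hPF, ← hQ, hPQ, Matrix.zero_mul,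
        add_zero]
    have e2 : Q * dpoint Z Y = Q * (Matrix.fromCols (0 : Matrix (Fin n) (Fin n) ℂ) Y)ᴴ
        * (frame Z * (frame Z)ᴴ)⁻¹ * frame Z := by
      simp only [dpoint, Matrix.mul_add, ← Matrix.mul_assoc, hQF, ← hQ, hQQ, Matrix.zero_mul,
        zero_add]
    rw [← Matrix.mul_assoc, e1, Matrix.mul_assoc, e2]
    simp only [Matrix.mul_assoc]
  have hG : (frame Z * (frame Z)ᴴ)⁻¹ * (frame Z * (frame Z)ᴴ) = 1 :=
    Matrix.nonsing_inv_mul _ (isUnit_gram Z)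
  rw [hprod, hE, Matrix.trace_mul_comm, Matrix.mul_assoc, Matrix.mul_assoc, hG, Matrix.mul_one,
    Matrix.trace_mul_comm, frame_mul_frame]

/-- In the Pontrjagin coordinates the Kähler form is
`(i/2) Tr [dZ (1 + Z⁺Z)⁻¹ ∧ dZ⁺ (1 + ZZ⁺)⁻¹]`. -/
theorem kahlerForm_point {n m : ℕ} (Z X Y : Matrix (Fin n) (Fin m) ℂ) :
    kahlerForm (point Z) (Matrix.of fun i j => deriv (fun t : ℝ => point (Z + t • X) i j) 0)
        (Matrix.of fun i j => deriv (fun t : ℝ => point (Z + t • Y) i j) 0) =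
      (Complex.I / 2 * (Matrix.trace (X * (1 + Zᴴ * Z)⁻¹ * Yᴴ * (1 + Z * Zᴴ)⁻¹)
        - Matrix.trace (Y * (1 + Zᴴ * Z)⁻¹ * Xᴴ * (1 + Z * Zᴴ)⁻¹))).re := by
  have h : ∀ W : Matrix (Fin n) (Fin m) ℂ,
      (Matrix.of fun i j => deriv (fun t : ℝ => point (Z + t • W) i j) 0) = dpoint Z W := by
    intro W
    ext i j
    exact (hasDerivAt_pi.1 (hasDerivAt_pi.1 (hasDerivAt_point Z W) i) j).deriv
  rw [h, h, kahlerForm, Matrix.mul_sub, Matrix.trace_sub, trace_dpoint, trace_dpoint]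

end CGrass

end

/-! ### Ordinary differential equations in a Banach space, with a parameter -/

noncomputable section

open Set Filter Topology MeasureTheory unitInterval

/-! Points are orthogonal projections, and up to a constant factor ω is the trace of the curvature
of the tautological bundle, so the area is a holonomy of its determinant line. Let U(s,t) be the
orthonormal frame that equals E = (1|0) at s = 0 and is parallel in s, that is, ∂ₛU = U ∂ₛσ. The
connection form α = Tr(∂ₜU U⁺) vanishes at s = 0 and satisfies Re((i/2) ∂ₛα) = ω(∂ₜσ, ∂ₛσ)
(`IsProjSurface.exists_radial_frame`). Hence 4i𝔍 = −2∫α over the side s = 1. If V is the frame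
parallel along that side with V(0) = U(1,0), then det(V U⁺) = exp(−∫₀ᵗα)
(`IsParallelFrame.det_mul_conjTranspose`).

Geodesics enter through one fact (`IsProjGeodesic.det_frame_mul_frame_zero`): a parallel frame along
a geodesic satisfies V'' = −BV with B constant and positive semidefinite, and V'(0)V(0)⁺ = 0, so
det(V(t)V(0)⁺) is a product of cosines, hence real. By `CGrass.det_one_add_mul`, det(1+ZW⁺) is
exp(−∫₀ᵗα) times real factors and the conjugate of 1/a, where a = det(U(1,t)E⁺). Compared with its
conjugate det(1+WZ⁺), it gains the factor exp(−2∫₀ᵗα)·a/ā.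

When the arc s ↦ σ(s,t) is a geodesic, a is real. At t = 1 this is the exponential identity, and for
a surface swept out by geodesics −2∫₀ᵗα is itself the branch. For a surface in the big cell,
det(U(s,t)E⁺) has no zeros on the square and is real on three of its edges, so a/ā has a continuous
logarithm on the fourth that vanishes at both ends (`exists_continuous_angle`); adding it to −2∫₀ᵗα
gives a branch with the same final value.

The side may leave the big cell or meet det(1+WZ⁺) = 0, but only at zeros of an analytic function
that is nonzero at t = 0. These are isolated, so by continuity any two branches agree
(`CGrass.IsLogBranch.eqOn`). -/

/-- A globally Lipschitz differential equation in a Banach space has a solution on all of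
`[0, 1]`. -/
theorem exists_hasDerivWithinAt_of_lipschitzWith {E : Type*} [NormedAddCommGroup E]
    [NormedSpace ℝ E] [CompleteSpace E] {f : ℝ → E → E} {K : NNReal}
    (hl : ∀ s ∈ Icc (0 : ℝ) 1, LipschitzWith K (f s))
    (hc : ∀ x, ContinuousOn (fun s => f s x) (Icc 0 1)) (x₀ : E) :
    ∃ u : ℝ → E, u 0 = x₀ ∧
      ∀ s ∈ Icc (0 : ℝ) 1, HasDerivWithinAt u (f s (u s)) (Icc 0 1) s := by
  -- Freezing the equation outside [0, 1] makes it continuous on all of ℝ, so that primitives can be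
  -- differentiated at the endpoints too.
  set F : ℝ → E → E := fun s x => f (projIcc 0 1 zero_le_one s) x with hF
  have hFf : ∀ s ∈ Icc (0 : ℝ) 1, F s = f s := by
    intro s hs; funext x; simp [hF, projIcc_of_mem zero_le_one hs]
  have hFl : ∀ s, LipschitzWith K (F s) := fun s => hl _ (projIcc 0 1 zero_le_one s).2
  have hFc : ∀ x, Continuous fun s => F s x := fun x =>
    (hc x).comp_continuous (continuous_subtype_val.comp continuous_projIcc) fun s =>
      (projIcc 0 1 zero_le_one s).2
  have hFj : Continuous (Function.uncurry F) := by
    have := continuous_prod_of_continuous_lipschitzWith' (fun p : ℝ × E => F p.1 p.2) K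
      (fun a => hFl a) (fun b => hFc b)
    exact this
  -- With the unknown written as exp(lam·s)·v, Picard iteration contracts on the whole interval at
  -- once, by the factor K/lam; any lam > K would do.
  set lam : ℝ := K + 1 with hlam
  have hK : (0 : ℝ) ≤ K := K.2
  have hlam0 : 0 < lam := by positivity
  let P : ℝ → I := projIcc 0 1 zero_le_one
  have hP : Continuous P := continuous_projIcc
  have hint : ∀ v : C(I, E), Continuous fun r => F r (Real.exp (lam * r) • v (P r)) := by
    intro v
    exact hFj.comp (continuous_id.prodMk
      ((Real.continuous_exp.comp (continuous_const.mul continuous_id)).smul (v.continuous.comp hP)))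
  have hprim : ∀ v : C(I, E), ∀ s, HasDerivAt
      (fun s => ∫ r in (0 : ℝ)..s, F r (Real.exp (lam * r) • v (P r)))
      (F s (Real.exp (lam * s) • v (P s))) s := fun v s =>
    intervalIntegral.integral_hasDerivAt_right ((hint v).intervalIntegrable _ _)
      ((hint v).stronglyMeasurableAtFilter _ _) (hint v).continuousAt
  let Φ : C(I, E) → C(I, E) := fun v =>
    ⟨fun s => Real.exp (-(lam * s)) •
      (x₀ + ∫ r in (0 : ℝ)..s, F r (Real.exp (lam * r) • v (P r))), by
      have : Continuous fun s : ℝ => ∫ r in (0 : ℝ)..s, F r (Real.exp (lam * r) • v (P r)) :=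
        continuous_iff_continuousAt.2 fun s => (hprim v s).continuousAt
      have h2 : Continuous fun s : ℝ => Real.exp (-(lam * s)) •
        (x₀ + ∫ r in (0 : ℝ)..s, F r (Real.exp (lam * r) • v (P r))) := by fun_prop
      exact h2.comp continuous_subtype_val⟩
  have hΦ : ContractingWith (K / (K + 1)) Φ := by
    refine ⟨?_, LipschitzWith.of_dist_le_mul fun v w => ?_⟩
    · rw [div_lt_one (by positivity)]; exact lt_add_one K
    rw [ContinuousMap.dist_le (by positivity)]
    intro s
    have hs : (0 : ℝ) ≤ s := s.2.1
    have e1 : dist (Φ v s) (Φ w s) = Real.exp (-(lam * s)) *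
        ‖∫ r in (0 : ℝ)..s, (F r (Real.exp (lam * r) • v (P r))
          - F r (Real.exp (lam * r) • w (P r)))‖ := by
      rw [intervalIntegral.integral_sub ((hint v).intervalIntegrable _ _)
        ((hint w).intervalIntegrable _ _)]
      simp only [Φ, ContinuousMap.coe_mk, dist_eq_norm]
      rw [← smul_sub, norm_smul, add_sub_add_left_eq_sub, Real.norm_eq_abs, Real.abs_exp]
    have e2 : ‖∫ r in (0 : ℝ)..s, (F r (Real.exp (lam * r) • v (P r))
          - F r (Real.exp (lam * r) • w (P r)))‖
        ≤ ∫ r in (0 : ℝ)..s, K * dist v w * Real.exp (lam * r) := by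
      refine intervalIntegral.norm_integral_le_of_norm_le hs
        (Eventually.of_forall fun r _ => ?_) ?_
      · rw [← dist_eq_norm]
        refine ((hFl r).dist_le_mul _ _).trans ?_
        rw [dist_eq_norm, ← smul_sub, norm_smul, Real.norm_eq_abs, Real.abs_exp, ← dist_eq_norm,
          mul_assoc, mul_comm (dist v w)]
        gcongr
        exact ContinuousMap.dist_apply_le_dist _
      · exact Continuous.intervalIntegrable (by fun_prop) _ _
    have e3 : ∫ r in (0 : ℝ)..s, K * dist v w * Real.exp (lam * r)
        = K * dist v w * ((Real.exp (lam * s) - 1) / lam) := by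
      simp [hlam0.ne', inv_mul_eq_div]
    rw [e1]
    calc _ ≤ Real.exp (-(lam * s)) * (K * dist v w * ((Real.exp (lam * s) - 1) / lam)) := by
          rw [← e3]; gcongr
      _ = K / lam * dist v w * (1 - Real.exp (-(lam * s))) := by
          have : Real.exp (-(lam * s)) * Real.exp (lam * s) = 1 := by
            rw [← Real.exp_add]; simp
          linear_combination (K * dist v w / lam) * this
      _ ≤ K / lam * dist v w * 1 := by
          gcongr
          linarith [Real.exp_pos (-(lam * s))]
      _ = _ := by rw [mul_one]; push_cast; rfl
  obtain ⟨v, hv⟩ : ∃ v, Φ v = v := ⟨_, hΦ.fixedPoint_isFixedPt⟩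
  have hv' : ∀ s : I, Real.exp (lam * s) • v s
      = x₀ + ∫ r in (0 : ℝ)..s, F r (Real.exp (lam * r) • v (P r)) := by
    intro s
    conv_lhs => rw [← hv]
    simp only [Φ, ContinuousMap.coe_mk]
    rw [smul_smul, ← Real.exp_add]; simp
  refine ⟨fun s => x₀ + ∫ r in (0 : ℝ)..s, F r (Real.exp (lam * r) • v (P r)), by simp, ?_⟩
  intro s hs
  have h := (hprim v s).const_add x₀
  have h2 := hv' ⟨s, hs⟩
  simp only at h2
  have h3 : P s = ⟨s, hs⟩ := projIcc_of_mem zero_le_one hs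
  rw [h3, h2, hFf s hs] at h
  exact h.hasDerivWithinAt


/-- Solutions of linear equations `u' = u a` in a Banach algebra exist on all of `[0, 1]`. -/
theorem exists_hasDerivWithinAt_mul {𝔸 : Type*} [NormedRing 𝔸] [NormedAlgebra ℝ 𝔸]
    [CompleteSpace 𝔸] {a : ℝ → 𝔸} (ha : ContinuousOn a (Icc 0 1)) (x₀ : 𝔸) :
    ∃ u : ℝ → 𝔸, u 0 = x₀ ∧
      ∀ s ∈ Icc (0 : ℝ) 1, HasDerivWithinAt u (u s * a s) (Icc 0 1) s := by
  obtain ⟨C, hC⟩ := isCompact_Icc.exists_bound_of_continuousOn ha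
  have hC0 : 0 ≤ C := (norm_nonneg _).trans (hC 0 (by simp))
  refine exists_hasDerivWithinAt_of_lipschitzWith (K := NNReal.mk C hC0) (f := fun s x => x * a s)
    (fun s hs => LipschitzWith.of_dist_le_mul fun x y => ?_)
    (fun x => continuousOn_const.mul ha) x₀
  rw [dist_eq_norm, dist_eq_norm, ← sub_mul]
  calc ‖(x - y) * a s‖ ≤ ‖x - y‖ * C := (norm_mul_le _ _).trans (by gcongr; exact hC s hs)
    _ = C * ‖x - y‖ := mul_comm _ _

/-- The parametrized integral `T ↦ ∫₀ᵗ T` as an operator on continuous functions on `[0, 1]`. -/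
def primitiveCLM (E : Type*) [NormedAddCommGroup E] [NormedSpace ℝ E] [CompleteSpace E] :
    C(I, E) →L[ℝ] C(I, E) :=
  LinearMap.mkContinuous
    { toFun := fun T => ⟨fun t => ∫ τ in (0 : ℝ)..t, T (projIcc 0 1 zero_le_one τ), by
        have h : Continuous fun τ : ℝ => T (projIcc 0 1 zero_le_one τ) :=
          T.continuous.comp continuous_projIcc
        exact (intervalIntegral.continuous_primitive
          (fun a b => h.intervalIntegrable a b) 0).comp continuous_subtype_val⟩
      map_add' := fun S T => by
        ext t
        have h : ∀ T : C(I, E), IntervalIntegrable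
            (fun τ : ℝ => T (projIcc 0 1 zero_le_one τ)) volume 0 t := fun T =>
          (T.continuous.comp continuous_projIcc).intervalIntegrable _ _
        simpa using intervalIntegral.integral_add (h S) (h T)
      map_smul' := fun c T => by
        ext t
        simp }
    1 fun T => by
      rw [one_mul]
      refine (ContinuousMap.norm_le _ (norm_nonneg _)).2 fun t => ?_
      have h : ‖∫ τ in (0 : ℝ)..t, T (projIcc 0 1 zero_le_one τ)‖ ≤ ‖T‖ * |(t : ℝ) - 0| :=
        intervalIntegral.norm_integral_le_of_norm_le_const fun τ _ => T.norm_coe_le_norm _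
      refine h.trans (mul_le_of_le_one_right (norm_nonneg _) ?_)
      rw [sub_zero, abs_of_nonneg t.2.1]
      exact t.2.2

theorem primitiveCLM_apply {E : Type*} [NormedAddCommGroup E] [NormedSpace ℝ E] [CompleteSpace E]
    (T : C(I, E)) (t : I) :
    primitiveCLM E T t = ∫ τ in (0 : ℝ)..t, T (projIcc 0 1 zero_le_one τ) := rfl

/-- The solution of `∂ₛ W = W A` with `W(0, t) = 1` in a Banach algebra depends differentiably on
the parameter `t`, and its derivative `T` solves the linearized equation. -/
theorem exists_parametric_transport {𝔸 : Type*} [NormedRing 𝔸] [NormedAlgebra ℝ 𝔸]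
    [CompleteSpace 𝔸] {A A' : ℝ → ℝ → 𝔸}
    (hA : ContinuousOn (Function.uncurry A) (Icc 0 1 ×ˢ Icc 0 1))
    (hA' : ContinuousOn (Function.uncurry A') (Icc 0 1 ×ˢ Icc 0 1))
    (hAA' : ∀ s ∈ Icc (0 : ℝ) 1, ∀ t ∈ Icc (0 : ℝ) 1,
      HasDerivWithinAt (A s) (A' s t) (Icc 0 1) t) :
    ∃ W T : ℝ → ℝ → 𝔸,
      (∀ t ∈ Icc (0 : ℝ) 1, W 0 t = 1) ∧ (∀ t ∈ Icc (0 : ℝ) 1, T 0 t = 0) ∧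
      ContinuousOn (Function.uncurry W) (Icc 0 1 ×ˢ Icc 0 1) ∧
      ContinuousOn (Function.uncurry T) (Icc 0 1 ×ˢ Icc 0 1) ∧
      ∀ s ∈ Icc (0 : ℝ) 1, ∀ t ∈ Icc (0 : ℝ) 1,
        HasDerivWithinAt (fun s => W s t) (W s t * A s t) (Icc 0 1) s ∧
        HasDerivWithinAt (W s) (T s t) (Icc 0 1) t ∧
        HasDerivWithinAt (fun s => T s t) (T s t * A s t + W s t * A' s t) (Icc 0 1) s := by
  let P : ℝ → I := projIcc 0 1 zero_le_one
  have hP : Continuous P := continuous_projIcc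
  have hPm : ∀ {t : ℝ}, t ∈ Icc (0 : ℝ) 1 → (P t : ℝ) = t := fun {t} ht => by
    simp [P, projIcc_of_mem zero_le_one ht]
  let cur : ∀ B : ℝ → ℝ → 𝔸, ContinuousOn (Function.uncurry B) (Icc 0 1 ×ˢ Icc 0 1) →
      C(ℝ, C(I, 𝔸)) := fun B hB => ContinuousMap.curry ⟨fun p : ℝ × I => B (P p.1) p.2,
        hB.comp_continuous (f := fun p : ℝ × I => ((P p.1 : ℝ), (p.2 : ℝ))) (by fun_prop)
          fun p => ⟨(P p.1).2, p.2.2⟩⟩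
  have hcur : ∀ B hB, ∀ s ∈ Icc (0 : ℝ) 1, ∀ t : I, cur B hB s t = B s t := by
    intro B hB s hs t
    change B (P s) t = B s t
    rw [hPm hs]
  set a := cur A hA with ha
  set a' := cur A' hA' with ha'
  -- Differentiable dependence on t comes from construction: solve for the would-be t-derivative T
  -- as a curve in `C(I, 𝔸)`, and define W as its primitive in t, starting from the solution u for t
  -- = 0.
  obtain ⟨u, hu0, hu⟩ := exists_hasDerivWithinAt_mul (a := fun s => A s 0)
    (hA.comp (f := fun s : ℝ => (s, (0 : ℝ))) (by fun_prop) fun s hs => ⟨hs, by simp⟩) 1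
  have huc : ContinuousOn u (Icc 0 1) := fun s hs => (hu s hs).continuousWithinAt
  let J := primitiveCLM 𝔸
  let cst : ℝ → C(I, 𝔸) := fun s => ContinuousMap.const I (u s)
  obtain ⟨C, hC⟩ := isCompact_Icc.exists_bound_of_continuousOn (s := Icc (0 : ℝ) 1)
    a.continuous.continuousOn
  obtain ⟨C', hC'⟩ := isCompact_Icc.exists_bound_of_continuousOn (s := Icc (0 : ℝ) 1)
    a'.continuous.continuousOn
  have hC0 : 0 ≤ C := (norm_nonneg _).trans (hC 0 (by simp))
  have hC0' : 0 ≤ C' := (norm_nonneg _).trans (hC' 0 (by simp))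
  obtain ⟨T, hT0, hT⟩ := exists_hasDerivWithinAt_of_lipschitzWith
    (K := NNReal.mk (C + ‖J‖ * C') (by positivity))
    (f := fun s T => T * a s + (cst s + J T) * a' s) (x₀ := 0)
    (fun s hs => LipschitzWith.of_dist_le_mul fun x y => by
      have e : x * a s + (cst s + J x) * a' s - (y * a s + (cst s + J y) * a' s)
          = (x - y) * a s + J (x - y) * a' s := by rw [map_sub, sub_mul, sub_mul, add_mul, add_mul]; abel
      rw [dist_eq_norm, dist_eq_norm, e, NNReal.coe_mk]
      calc _ ≤ ‖x - y‖ * ‖a s‖ + ‖J (x - y)‖ * ‖a' s‖ :=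
            (norm_add_le _ _).trans (add_le_add (norm_mul_le _ _) (norm_mul_le _ _))
        _ ≤ ‖x - y‖ * C + (‖J‖ * ‖x - y‖) * C' := by
            gcongr
            · exact hC s hs
            · exact J.le_opNorm _
            · exact hC' s hs
        _ = _ := by ring)
    (fun x => by
      have h1 : ContinuousOn cst (Icc 0 1) :=
        (ContinuousMap.continuous_const').comp_continuousOn huc
      exact (continuousOn_const.mul a.continuous.continuousOn).add
        ((h1.add continuousOn_const).mul a'.continuous.continuousOn))
  have hTc : ContinuousOn T (Icc 0 1) := fun s hs => (hT s hs).continuousWithinAt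
  have hev : ∀ t : I, ∀ {f : ℝ → C(I, 𝔸)} {f' : C(I, 𝔸)} {s : ℝ},
      HasDerivWithinAt f f' (Icc 0 1) s →
      HasDerivWithinAt (fun s => f s t) (f' t) (Icc 0 1) s := fun t f f' s hf =>
    ((ContinuousMap.evalCLM ℝ t : C(I, 𝔸) →L[ℝ] 𝔸)).hasFDerivAt.comp_hasDerivWithinAt s hf
  have hunc : ∀ {f : ℝ → C(I, 𝔸)}, ContinuousOn f (Icc 0 1) →
      ContinuousOn (fun p : ℝ × ℝ => f p.1 (P p.2)) (Icc 0 1 ×ˢ Icc 0 1) := by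
    intro f hf
    have h1 : ContinuousOn (fun p : ℝ × ℝ => f p.1) (Icc 0 1 ×ˢ Icc 0 1) :=
      hf.comp continuousOn_fst fun p hp => hp.1
    have h2 : ContinuousOn (fun p : ℝ × ℝ => P p.2) (Icc 0 1 ×ˢ Icc 0 1) := by fun_prop
    exact (continuous_eval (F := C(I, 𝔸))).comp_continuousOn (h1.prodMk h2)
  have hJd : ∀ x : C(I, 𝔸), ∀ t ∈ Icc (0 : ℝ) 1,
      HasDerivWithinAt (fun t => J x (P t)) (x (P t)) (Icc 0 1) t := by
    intro x t ht
    have hx : Continuous fun τ => x (P τ) := x.continuous.comp hP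
    have h := intervalIntegral.integral_hasDerivAt_right (hx.intervalIntegrable 0 t)
      (hx.stronglyMeasurableAtFilter _ _) hx.continuousAt
    refine h.hasDerivWithinAt.congr_of_mem (fun τ hτ => ?_) ht
    simp only [J, primitiveCLM_apply, hPm hτ]
    rfl
  have hWt : ∀ s : ℝ, ∀ t ∈ Icc (0 : ℝ) 1, HasDerivWithinAt
      (fun t => u s + J (T s) (P t)) (T s (P t)) (Icc 0 1) t := fun s t ht =>
    (hJd (T s) t ht).const_add _
  refine ⟨fun s t => u s + J (T s) (P t), fun s t => T s (P t), ?_, ?_, ?_, ?_, ?_⟩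
  · intro t _; simp [hu0, hT0]
  · intro t _; simp [hT0]
  · refine (huc.comp continuousOn_fst fun p hp => hp.1).add ?_
    exact hunc (f := fun s => J (T s)) (J.continuous.comp_continuousOn hTc)
  · exact hunc hTc
  · intro s hs t ht
    refine ⟨?_, hWt s t ht, ?_⟩
    -- Since ∂ₛT = T A + W A' is the t-derivative of W A, integrating it over [0, t] returns W A
    -- minus its value at t = 0, which is the derivative of u.
    · have h1 := hev (P t) (J.hasFDerivAt.comp_hasDerivWithinAt s (hT s hs))
      have h2 := (hu s hs).add h1
      refine h2.congr_deriv ?_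
      set D : C(I, 𝔸) := T s * a s + (cst s + J (T s)) * a' s with hD
      have h3 : J D (P t) = ∫ τ in (0 : ℝ)..t, D (P τ) := by
        simp only [J, primitiveCLM_apply, hPm ht]; rfl
      have hsub : uIcc 0 t ⊆ Icc 0 1 := by
        rw [uIcc_of_le ht.1]; exact Icc_subset_Icc_right ht.2
      have h4 : ∀ τ ∈ uIcc 0 t, HasDerivWithinAt
          (fun τ => (u s + J (T s) (P τ)) * A s τ) (D (P τ)) (uIcc 0 t) τ := by
        intro τ hτ
        have := ((hWt s τ (hsub hτ)).mul (hAA' s hs τ (hsub hτ))).mono hsub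
        refine this.congr_deriv ?_
        simp [hD, hcur, ha, ha', hs, hPm (hsub hτ), cst]
      have h5 : ∫ τ in (0 : ℝ)..t, D (P τ)
          = (u s + J (T s) (P t)) * A s t - (u s + J (T s) (P 0)) * A s 0 :=
        intervalIntegral.integral_eq_sub_of_hasDeriv_right
          (fun τ hτ => (h4 τ hτ).continuousWithinAt)
          (fun τ hτ => ((h4 τ (Ioo_subset_Icc_self hτ)).hasDerivAt
            (Icc_mem_nhds hτ.1 hτ.2)).hasDerivWithinAt)
          ((D.continuous.comp hP).intervalIntegrable _ _)
      have h6 : J (T s) (P 0) = 0 := by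
        simp [J, primitiveCLM_apply, P]
      change u s * A s 0 + J D (P t) = _
      rw [h3, h5, h6]
      simp
    · refine (hev (P t) (hT s hs)).congr_deriv ?_
      simp [hcur, ha, ha', hs, hPm ht, cst]

end

/-! ### Entrywise matrix calculus and parallel frames of curves of projections -/

noncomputable section

open Set Filter Topology MeasureTheory

/-- Grönwall's inequality, with the sum of the bounds of the two coefficients as constant. -/
theorem eq_zero_of_hasDerivWithinAt_mul_add_mul {𝔸 : Type*} [NormedRing 𝔸] [NormedAlgebra ℝ 𝔸]
    {a b D : ℝ → 𝔸} (ha : ContinuousOn a (Icc 0 1)) (hb : ContinuousOn b (Icc 0 1))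
    (hD : ∀ s ∈ Icc (0 : ℝ) 1, HasDerivWithinAt D (a s * D s + D s * b s) (Icc 0 1) s)
    (h0 : D 0 = 0) {s : ℝ} (hs : s ∈ Icc (0 : ℝ) 1) : D s = 0 := by
  obtain ⟨C, hC⟩ := isCompact_Icc.exists_bound_of_continuousOn ha
  obtain ⟨C', hC'⟩ := isCompact_Icc.exists_bound_of_continuousOn hb
  refine eq_zero_of_abs_deriv_le_mul_abs_self_of_eq_zero_right (K := C + C')
    (fun s hs => (hD s hs).continuousWithinAt)
    (fun s hs => (hD s (Ico_subset_Icc_self hs)).mono_of_mem_nhdsWithin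
      (Icc_mem_nhdsGE_of_mem hs)) h0 (fun s hs => ?_) s hs
  have hs' := Ico_subset_Icc_self hs
  calc _ ≤ ‖a s‖ * ‖D s‖ + ‖D s‖ * ‖b s‖ :=
        (norm_add_le _ _).trans (add_le_add (norm_mul_le _ _) (norm_mul_le _ _))
    _ ≤ C * ‖D s‖ + ‖D s‖ * C' := by
        gcongr
        · exact hC s hs'
        · exact hC' s hs'
    _ = _ := by ring

namespace Matrix

theorem hasDerivWithinAt_iff {ι κ : Type*} [Finite ι] [Finite κ] {A : ℝ → Matrix ι κ ℂ}
    {A' : Matrix ι κ ℂ} {S : Set ℝ} {t : ℝ} :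
    HasDerivWithinAt A A' S t ↔ ∀ i j, HasDerivWithinAt (fun s => A s i j) (A' i j) S t := by
  have := Fintype.ofFinite ι
  have := Fintype.ofFinite κ
  exact hasDerivWithinAt_pi.trans (forall_congr' fun i => hasDerivWithinAt_pi)

theorem hasDerivWithinAt_unique {ι κ : Type*} [Finite ι] [Finite κ] {A : ℝ → Matrix ι κ ℂ}
    {B C : Matrix ι κ ℂ} {t : ℝ} (ht : t ∈ Icc (0 : ℝ) 1)
    (hB : HasDerivWithinAt A B (Icc 0 1) t) (hC : HasDerivWithinAt A C (Icc 0 1) t) : B = C := by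
  ext i j
  exact (uniqueDiffOn_Icc zero_lt_one t ht).eq_deriv _ (hasDerivWithinAt_iff.1 hB i j)
    (hasDerivWithinAt_iff.1 hC i j)

theorem hasDerivWithinAt_matMul {ι κ μ : Type*} [Finite ι] [Fintype κ] [Finite μ]
    {A : ℝ → Matrix ι κ ℂ} {B : ℝ → Matrix κ μ ℂ} {A' : Matrix ι κ ℂ} {B' : Matrix κ μ ℂ}
    {S : Set ℝ} {t : ℝ} (hA : HasDerivWithinAt A A' S t) (hB : HasDerivWithinAt B B' S t) :
    HasDerivWithinAt (fun s => A s * B s) (A' * B t + A t * B') S t := by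
  refine hasDerivWithinAt_iff.2 fun i j => ?_
  have := HasDerivWithinAt.fun_sum (u := Finset.univ) fun k _ =>
    (hasDerivWithinAt_iff.1 hA i k).mul (hasDerivWithinAt_iff.1 hB k j)
  simpa [Matrix.mul_apply, Finset.sum_add_distrib] using this

theorem hasDerivWithinAt_const {ι κ : Type*} [Finite ι] [Finite κ] (A : Matrix ι κ ℂ)
    (S : Set ℝ) (t : ℝ) : HasDerivWithinAt (fun _ => A) (0 : Matrix ι κ ℂ) S t :=
  hasDerivWithinAt_iff.2 fun i j => _root_.hasDerivWithinAt_const t S (A i j)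

theorem hasDerivWithinAt_sub {ι κ : Type*} [Finite ι] [Finite κ] {A B : ℝ → Matrix ι κ ℂ}
    {A' B' : Matrix ι κ ℂ} {S : Set ℝ} {t : ℝ} (hA : HasDerivWithinAt A A' S t)
    (hB : HasDerivWithinAt B B' S t) : HasDerivWithinAt (fun s => A s - B s) (A' - B') S t :=
  hasDerivWithinAt_iff.2 fun i j =>
    (hasDerivWithinAt_iff.1 hA i j).sub (hasDerivWithinAt_iff.1 hB i j)

theorem hasDerivWithinAt_congr {ι κ : Type*} [Finite ι] [Finite κ] {A B : ℝ → Matrix ι κ ℂ}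
    {A' : Matrix ι κ ℂ} {S : Set ℝ} {t : ℝ} (hA : HasDerivWithinAt A A' S t)
    (hAB : ∀ s ∈ S, B s = A s) (ht : t ∈ S) : HasDerivWithinAt B A' S t :=
  hasDerivWithinAt_iff.2 fun i j => (hasDerivWithinAt_iff.1 hA i j).congr_of_mem
    (fun s hs => by rw [hAB s hs]) ht

theorem hasDerivWithinAt_const_mul {ι κ μ : Type*} [Finite ι] [Fintype κ] [Finite μ]
    (A : Matrix ι κ ℂ) {B : ℝ → Matrix κ μ ℂ} {B' : Matrix κ μ ℂ}
    {S : Set ℝ} {t : ℝ} (hB : HasDerivWithinAt B B' S t) :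
    HasDerivWithinAt (fun s => A * B s) (A * B') S t := by
  simpa using hasDerivWithinAt_matMul (hasDerivWithinAt_const A S t) hB

theorem hasDerivWithinAt_conjTranspose {ι κ : Type*} [Finite ι] [Finite κ]
    {A : ℝ → Matrix ι κ ℂ} {A' : Matrix ι κ ℂ} {S : Set ℝ} {t : ℝ}
    (hA : HasDerivWithinAt A A' S t) : HasDerivWithinAt (fun s => (A s)ᴴ) A'ᴴ S t :=
  hasDerivWithinAt_iff.2 fun i j => (hasDerivWithinAt_iff.1 hA j i).star

theorem hasDerivWithinAt_trace {ι : Type*} [Fintype ι]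
    {A : ℝ → Matrix ι ι ℂ} {A' : Matrix ι ι ℂ} {S : Set ℝ} {t : ℝ}
    (hA : HasDerivWithinAt A A' S t) : HasDerivWithinAt (fun s => (A s).trace) A'.trace S t :=
  HasDerivWithinAt.fun_sum fun i _ => hasDerivWithinAt_iff.1 hA i i

theorem eq_zero_of_hasDerivWithinAt {κ : Type*} [Fintype κ]
    {a b D : ℝ → Matrix κ κ ℂ} (ha : ContinuousOn a (Icc 0 1)) (hb : ContinuousOn b (Icc 0 1))
    (hD : ∀ s ∈ Icc (0 : ℝ) 1, HasDerivWithinAt D (a s * D s + D s * b s) (Icc 0 1) s)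
    (h0 : D 0 = 0) {s : ℝ} (hs : s ∈ Icc (0 : ℝ) 1) : D s = 0 := by
  classical
  let := Matrix.linftyOpNormedRing (n := κ) (α := ℂ)
  let := Matrix.linftyOpNormedAlgebra (n := κ) (α := ℂ) (R := ℝ)
  exact eq_zero_of_hasDerivWithinAt_mul_add_mul ha hb hD h0 hs

theorem eq_of_hasDerivWithinAt_zero {κ : Type*} [Fintype κ] {D : ℝ → Matrix κ κ ℂ}
    (hD : ∀ s ∈ Icc (0 : ℝ) 1, HasDerivWithinAt D 0 (Icc 0 1) s) {s : ℝ}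
    (hs : s ∈ Icc (0 : ℝ) 1) : D s = D 0 := by
  have := eq_zero_of_hasDerivWithinAt (D := fun s => D s - D 0) (a := fun _ => 0) (b := fun _ => 0)
    continuousOn_const continuousOn_const (fun s hs => by
      simpa using hasDerivWithinAt_sub (hD s hs) (hasDerivWithinAt_const (D 0) _ _))
    (by simp) hs
  exact sub_eq_zero.1 this

end Matrix

open Matrix

variable {ι κ : Type*} [Fintype ι] [DecidableEq ι] [Fintype κ]

/-- `c` is a `C¹` curve of orthogonal projections on `[0, 1]` with velocity `c'`. -/
structure IsProjCurve (c c' : ℝ → Matrix κ κ ℂ) : Prop where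
  herm : ∀ s ∈ Icc (0 : ℝ) 1, (c s)ᴴ = c s
  idem : ∀ s ∈ Icc (0 : ℝ) 1, c s * c s = c s
  deriv : ∀ s ∈ Icc (0 : ℝ) 1, HasDerivWithinAt c (c' s) (Icc 0 1) s
  cont : ContinuousOn c' (Icc 0 1)

namespace IsProjCurve

variable {c c' : ℝ → Matrix κ κ ℂ}

theorem deriv_herm (hc : IsProjCurve c c') {s : ℝ} (hs : s ∈ Icc (0 : ℝ) 1) :
    (c' s)ᴴ = c' s := by
  have h := hasDerivWithinAt_conjTranspose (hc.deriv s hs)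
  exact hasDerivWithinAt_unique hs (hasDerivWithinAt_congr h (fun t ht => (hc.herm t ht).symm) hs)
    (hc.deriv s hs)

theorem deriv_eq (hc : IsProjCurve c c') {s : ℝ} (hs : s ∈ Icc (0 : ℝ) 1) :
    c' s * c s + c s * c' s = c' s := by
  have h := hasDerivWithinAt_matMul (hc.deriv s hs) (hc.deriv s hs)
  exact hasDerivWithinAt_unique hs (hasDerivWithinAt_congr h (fun t ht => (hc.idem t ht).symm) hs)
    (hc.deriv s hs)

/-- A velocity is off-diagonal with respect to the splitting given by the projection: multiply the
differentiated idempotent law by `c s`. This is what makes the equation V' = V c' parallel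
transport. -/
theorem mul_deriv_mul (hc : IsProjCurve c c') {s : ℝ} (hs : s ∈ Icc (0 : ℝ) 1) :
    c s * c' s * c s = 0 := by
  have h := congrArg (fun M => c s * M) (hc.deriv_eq hs)
  have h' : c s * c' s * c s + c s * c s * c' s = c s * c' s := by
    simpa only [Matrix.mul_add, Matrix.mul_assoc] using h
  rw [hc.idem s hs] at h'
  exact add_eq_right.1 h'

end IsProjCurve

/-- `V` is a parallel orthonormal frame of the row spaces of the projections `c s`. -/
structure IsParallelFrame (c c' : ℝ → Matrix κ κ ℂ) (V : ℝ → Matrix ι κ ℂ) : Prop where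
  deriv : ∀ s ∈ Icc (0 : ℝ) 1, HasDerivWithinAt V (V s * c' s) (Icc 0 1) s
  orth : ∀ s ∈ Icc (0 : ℝ) 1, V s * (V s)ᴴ = 1
  proj : ∀ s ∈ Icc (0 : ℝ) 1, (V s)ᴴ * V s = c s

namespace IsParallelFrame

variable {c c' : ℝ → Matrix κ κ ℂ} {V : ℝ → Matrix ι κ ℂ}

theorem mul_proj (hV : IsParallelFrame c c' V) {s : ℝ} (hs : s ∈ Icc (0 : ℝ) 1) :
    V s * c s = V s := by
  rw [← hV.proj s hs, ← Matrix.mul_assoc, hV.orth s hs, Matrix.one_mul]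

theorem mul_deriv_mul_conjTranspose (hV : IsParallelFrame c c' V) (hc : IsProjCurve c c') {s : ℝ}
    (hs : s ∈ Icc (0 : ℝ) 1) : V s * c' s * (V s)ᴴ = 0 := by
  have h : (V s)ᴴ = c s * (V s)ᴴ := by
    rw [← hV.proj s hs, Matrix.mul_assoc, hV.orth s hs, Matrix.mul_one]
  calc V s * c' s * (V s)ᴴ = V s * c s * c' s * (c s * (V s)ᴴ) := by rw [hV.mul_proj hs, ← h]
    _ = V s * (c s * c' s * c s) * (V s)ᴴ := by simp only [Matrix.mul_assoc]
    _ = 0 := by rw [hc.mul_deriv_mul hs]; simp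

-- The defect V⁺V − c solves a homogeneous linear equation and so stays zero. Then V c = V, the
-- velocity block V c' V⁺ vanishes, and VV⁺ is constant.
open scoped ComplexOrder in
theorem of_hasDerivWithinAt (hc : IsProjCurve c c')
    (hV : ∀ s ∈ Icc (0 : ℝ) 1, HasDerivWithinAt V (V s * c' s) (Icc 0 1) s)
    (h0 : V 0 * (V 0)ᴴ = 1) (h0' : (V 0)ᴴ * V 0 = c 0) : IsParallelFrame c c' V := by
  have hH : ∀ s ∈ Icc (0 : ℝ) 1,
      HasDerivWithinAt (fun s => (V s)ᴴ) (c' s * (V s)ᴴ) (Icc 0 1) s := by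
    intro s hs
    have := hasDerivWithinAt_conjTranspose (hV s hs)
    rwa [conjTranspose_mul, hc.deriv_herm hs] at this
  have hproj : ∀ s ∈ Icc (0 : ℝ) 1, (V s)ᴴ * V s = c s := by
    intro s hs
    refine sub_eq_zero.1 (eq_zero_of_hasDerivWithinAt (D := fun s => (V s)ᴴ * V s - c s)
      hc.cont hc.cont (fun s hs => ?_) (by simp [h0']) hs)
    convert hasDerivWithinAt_sub (hasDerivWithinAt_matMul (hH s hs) (hV s hs))
      (hc.deriv s hs) using 1
    calc _ = c' s * (V s)ᴴ * V s + (V s)ᴴ * (V s * c' s) - (c' s * c s + c s * c' s) := by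
          simp only [Matrix.mul_sub, Matrix.sub_mul, Matrix.mul_assoc]
          abel
      _ = _ := by rw [hc.deriv_eq hs]
  have hmul : ∀ s ∈ Icc (0 : ℝ) 1, V s * c s = V s := by
    intro s hs
    have h1 : (V s - V s * c s)ᴴ * (V s - V s * c s) = 0 := by
      have e1 : (V s - V s * c s)ᴴ * (V s - V s * c s)
          = (V s)ᴴ * V s - (V s)ᴴ * V s * c s - (c s * ((V s)ᴴ * V s)
            - c s * ((V s)ᴴ * V s) * c s) := by
        simp only [conjTranspose_sub, conjTranspose_mul, hc.herm s hs, Matrix.mul_sub,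
          Matrix.sub_mul, Matrix.mul_assoc]
        abel
      rw [e1, hproj s hs, hc.idem s hs, hc.idem s hs]; simp
    exact (sub_eq_zero.1 (conjTranspose_mul_self_eq_zero.1 h1)).symm
  have hzero : ∀ s ∈ Icc (0 : ℝ) 1, V s * c' s * (V s)ᴴ = 0 := by
    intro s hs
    calc V s * c' s * (V s)ᴴ = V s * c s * c' s * (V s * c s)ᴴ := by rw [hmul s hs]
      _ = V s * (c s * c' s * c s) * (V s)ᴴ := by
        simp only [conjTranspose_mul, hc.herm s hs, Matrix.mul_assoc]
      _ = 0 := by rw [hc.mul_deriv_mul hs]; simp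
  refine ⟨hV, fun s hs => ?_, hproj⟩
  rw [← h0]
  refine eq_of_hasDerivWithinAt_zero (D := fun s => V s * (V s)ᴴ) (fun s hs => ?_) hs
  convert hasDerivWithinAt_matMul (hV s hs) (hH s hs) using 1
  rw [← Matrix.mul_assoc, hzero s hs, add_zero]

end IsParallelFrame

theorem IsProjCurve.exists_isParallelFrame [DecidableEq κ] {c c' : ℝ → Matrix κ κ ℂ} (hc : IsProjCurve c c')
    {V₀ : Matrix ι κ ℂ} (h0 : V₀ * V₀ᴴ = 1) (h0' : V₀ᴴ * V₀ = c 0) :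
    ∃ V : ℝ → Matrix ι κ ℂ, V 0 = V₀ ∧ IsParallelFrame c c' V := by
  obtain ⟨u, hu0, hu⟩ : ∃ u : ℝ → Matrix κ κ ℂ, u 0 = 1 ∧
      ∀ s ∈ Icc (0 : ℝ) 1, HasDerivWithinAt u (u s * c' s) (Icc 0 1) s := by
    classical
    let := Matrix.linftyOpNormedRing (n := κ) (α := ℂ)
    let := Matrix.linftyOpNormedAlgebra (n := κ) (α := ℂ) (R := ℝ)
    exact exists_hasDerivWithinAt_mul hc.cont 1
  refine ⟨fun s => V₀ * u s, by simp [hu0], .of_hasDerivWithinAt hc (fun s hs => ?_) ?_ ?_⟩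
  · have := hasDerivWithinAt_const_mul V₀ (hu s hs)
    rwa [← Matrix.mul_assoc] at this
  · simpa [hu0] using h0
  · simpa [hu0] using h0'

end

/-! ### Geodesics of projections: the parallel frame as a harmonic oscillator -/

noncomputable section

open Set Filter Topology MeasureTheory

open Matrix

variable {ι κ : Type*} [Fintype ι] [DecidableEq ι] [Fintype κ]

/-- The solution of `S'' = -b² S` with `S 0 = 0` and `S' 0 = 1`. -/
def sinScaled (b t : ℝ) : ℝ := if b = 0 then t else Real.sin (b * t) / b

theorem sinScaled_mul (b t : ℝ) : b * sinScaled b t = Real.sin (b * t) := by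
  unfold sinScaled
  split_ifs with h
  · simp [h]
  · field_simp

theorem hasDerivAt_sinScaled (b t : ℝ) : HasDerivAt (sinScaled b) (Real.cos (b * t)) t := by
  unfold sinScaled
  by_cases h : b = 0
  · simpa [h] using hasDerivAt_id' t
  · simp only [h, if_false]
    have := (((hasDerivAt_id t).const_mul b).sin).div_const b
    simpa [h] using this

open scoped ContDiff in
theorem contDiff_sinScaled (b : ℝ) : ContDiff ℝ ω (sinScaled b) := by
  unfold sinScaled
  by_cases h : b = 0
  · simpa [h] using contDiff_fun_id
  · simp only [h, if_false]
    exact (Real.contDiff_sin.comp (contDiff_const.mul contDiff_id)).div_const b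

/-- Rotating (y, y') back by the fundamental solution gives the two conserved quantities `e1` and
`e2`, and y is recovered from them by cos² + sin² = 1. -/
theorem harmonic_oscillator {y y' : ℝ → ℂ} {b : ℝ}
    (h : ∀ t ∈ Icc (0 : ℝ) 1, HasDerivWithinAt y (y' t) (Icc 0 1) t)
    (h' : ∀ t ∈ Icc (0 : ℝ) 1, HasDerivWithinAt y' (-(b ^ 2 : ℝ) * y t) (Icc 0 1) t)
    {t : ℝ} (ht : t ∈ Icc (0 : ℝ) 1) :
    y t = (Real.cos (b * t) : ℝ) * y 0 + (sinScaled b t : ℝ) * y' 0 := by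
  have hcos : ∀ t, HasDerivAt (fun t => ((Real.cos (b * t) : ℝ) : ℂ))
      ((-Real.sin (b * t) * b : ℝ) : ℂ) t := fun t => by
    have := ((hasDerivAt_id t).const_mul b).cos
    simpa using this.ofReal_comp
  have hsin : ∀ t, HasDerivAt (fun t => ((sinScaled b t : ℝ) : ℂ))
      ((Real.cos (b * t) : ℝ) : ℂ) t := fun t => (hasDerivAt_sinScaled b t).ofReal_comp
  have hconst : ∀ f : ℝ → ℂ, (∀ t ∈ Icc (0 : ℝ) 1, HasDerivWithinAt f 0 (Icc 0 1) t) →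
      f t = f 0 := fun f hf =>
    constant_of_derivWithin_zero (fun t ht => (hf t ht).differentiableWithinAt)
      (fun t ht => (hf t (Ico_subset_Icc_self ht)).derivWithin
        (uniqueDiffOn_Icc zero_lt_one t (Ico_subset_Icc_self ht))) t ht
  have hbs : ∀ t, (b : ℂ) * ((sinScaled b t : ℝ) : ℂ) = ((Real.sin (b * t) : ℝ) : ℂ) :=
    fun t => by rw [← Complex.ofReal_mul, sinScaled_mul]
  have e1 := hconst (fun t => (Real.cos (b * t) : ℝ) * y t - (sinScaled b t : ℝ) * y' t)
    fun t ht => by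
      refine (((hcos t).hasDerivWithinAt.mul (h t ht)).sub
        ((hsin t).hasDerivWithinAt.mul (h' t ht))).congr_deriv ?_
      have := hbs t
      push_cast at this ⊢
      linear_combination (b : ℂ) * y t * this
  have e2 := hconst (fun t => (b * Real.sin (b * t) : ℝ) * y t + (Real.cos (b * t) : ℝ) * y' t)
    fun t ht => by
      have hd : HasDerivAt (fun t => ((b * Real.sin (b * t) : ℝ) : ℂ))
          ((b * (Real.cos (b * t) * b) : ℝ) : ℂ) t := by
        have := (((hasDerivAt_id t).const_mul b).sin.const_mul b)
        simpa using this.ofReal_comp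
      refine ((hd.hasDerivWithinAt.mul (h t ht)).add
        ((hcos t).hasDerivWithinAt.mul (h' t ht))).congr_deriv ?_
      push_cast
      ring
  simp only [mul_zero, Real.cos_zero, Real.sin_zero, Complex.ofReal_zero, Complex.ofReal_one,
    zero_mul, one_mul, zero_add] at e1 e2
  have h0 : sinScaled b 0 = 0 := by simp [sinScaled]
  rw [h0, Complex.ofReal_zero, zero_mul, sub_zero] at e1
  rw [← e1, ← e2]
  have := hbs t
  have hcs : ((Real.cos (b * t) : ℝ) : ℂ) ^ 2 + ((Real.sin (b * t) : ℝ) : ℂ) ^ 2 = 1 := by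
    exact_mod_cast Real.cos_sq_add_sin_sq (b * t)
  rw [Complex.ofReal_mul b]
  linear_combination (-y t) * hcs - (Real.sin (b * t) : ℂ) * y t * this

open scoped ComplexOrder in
/-- The solution of `V'' = -B V` for a positive semidefinite matrix `B`. -/
theorem matrix_harmonic_oscillator {V V' : ℝ → Matrix ι κ ℂ} {W : Matrix ι κ ℂ}
    (h : ∀ t ∈ Icc (0 : ℝ) 1, HasDerivWithinAt V (V' t) (Icc 0 1) t)
    (h' : ∀ t ∈ Icc (0 : ℝ) 1, HasDerivWithinAt V' (-(W * Wᴴ * V t)) (Icc 0 1) t) :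
    ∃ (Q : Matrix ι ι ℂ) (b : ι → ℝ), Q * Qᴴ = 1 ∧ ∀ t ∈ Icc (0 : ℝ) 1,
      V t = Q * diagonal (fun i => ((Real.cos (b i * t) : ℝ) : ℂ)) * Qᴴ * V 0
        + Q * diagonal (fun i => ((sinScaled (b i) t : ℝ) : ℂ)) * Qᴴ * V' 0 := by
  have hpos : 0 ≤ (isHermitian_mul_conjTranspose_self W).eigenvalues :=
    (posSemidef_self_mul_conjTranspose W).eigenvalues_nonneg
  have hsp := (isHermitian_mul_conjTranspose_self W).spectral_theorem
  set U := (isHermitian_mul_conjTranspose_self W).eigenvectorUnitary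
  set ev := (isHermitian_mul_conjTranspose_self W).eigenvalues
  set Q : Matrix ι ι ℂ := U.1 with hQ
  have hQQ : Q * Qᴴ = 1 := Unitary.coe_mul_star_self U
  have hQQ' : Qᴴ * Q = 1 := Unitary.coe_star_mul_self U
  rw [Unitary.conjStarAlgAut_apply] at hsp
  have hB : Qᴴ * (W * Wᴴ) = diagonal (fun i => ((ev i : ℝ) : ℂ)) * Qᴴ := by
    rw [hsp, Matrix.mul_assoc, ← Matrix.mul_assoc Qᴴ, ← hQ, hQQ', Matrix.one_mul]
    rfl
  -- Diagonalizing WW⁺ decouples the rows of Qᴴ V into scalar oscillators. Zero eigenvalues are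
  -- allowed, which is why `sinScaled` treats the frequency 0 separately.
  refine ⟨Q, fun i => Real.sqrt (ev i), hQQ, fun t ht => ?_⟩
  have key : Qᴴ * V t = diagonal (fun i => ((Real.cos (Real.sqrt (ev i) * t) : ℝ) : ℂ)) * (Qᴴ * V 0)
      + diagonal (fun i => ((sinScaled (Real.sqrt (ev i)) t : ℝ) : ℂ)) * (Qᴴ * V' 0) := by
    ext i j
    rw [Matrix.add_apply, Matrix.diagonal_mul, Matrix.diagonal_mul]
    refine harmonic_oscillator (y := fun t => (Qᴴ * V t) i j) (y' := fun t => (Qᴴ * V' t) i j)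
      (fun t ht => hasDerivWithinAt_iff.1 (hasDerivWithinAt_const_mul Qᴴ (h t ht)) i j)
      (fun t ht => ?_) ht
    have := hasDerivWithinAt_iff.1 (hasDerivWithinAt_const_mul Qᴴ (h' t ht)) i j
    rw [Matrix.mul_neg, ← Matrix.mul_assoc, hB, Matrix.mul_assoc, Matrix.neg_apply,
      Matrix.diagonal_mul] at this
    rw [Real.sq_sqrt (hpos i), neg_mul]
    exact this
  calc V t = Q * (Qᴴ * V t) := by rw [← Matrix.mul_assoc, hQQ, Matrix.one_mul]
    _ = _ := by rw [key]; simp only [Matrix.mul_add, Matrix.mul_assoc]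

open scoped ContDiff in
theorem contDiff_mul_const_apply {α β γ : Type*} [Fintype β] {A : ℝ → Matrix α β ℂ}
    {B : Matrix β γ ℂ} (hA : ∀ i j, ContDiff ℝ ω fun t => A t i j) (i : α) (j : γ) :
    ContDiff ℝ ω fun t => (A t * B) i j := by
  simp only [Matrix.mul_apply]
  exact ContDiff.sum fun k _ => (hA i k).mul contDiff_const

/-- `c` is a geodesic of the manifold of orthogonal projections, with velocity `c'` and ambient
acceleration `c''`: the latter has no tangential component. -/
structure IsProjGeodesic (c c' c'' : ℝ → Matrix κ κ ℂ) : Prop extends IsProjCurve c c' where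
  deriv₂ : ∀ s ∈ Icc (0 : ℝ) 1, HasDerivWithinAt c' (c'' s) (Icc 0 1) s
  normal : ∀ s ∈ Icc (0 : ℝ) 1, c s * c'' s * c s = c s * c'' s

namespace IsProjGeodesic

-- The next result reduces the geodesic equation to constant coefficients. The rows of V'' stay in
-- the subspace of c, because c commutes with c'² and c'' is normal, and V'V⁺ = 0 differentiates to
-- V''V⁺ = −V'V'⁺. Hence V'' = −(V'V'⁺)V, and V'V'⁺ is constant.
variable {c c' c'' : ℝ → Matrix κ κ ℂ} {V : ℝ → Matrix ι κ ℂ}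

theorem hasDerivWithinAt_frame_deriv (hc : IsProjGeodesic c c' c'') (hV : IsParallelFrame c c' V)
    {t : ℝ} (ht : t ∈ Icc (0 : ℝ) 1) :
    HasDerivWithinAt (fun t => V t * c' t)
      (-((V 0 * c' 0) * (V 0 * c' 0)ᴴ * V t)) (Icc 0 1) t := by
  have hp := hc.toIsProjCurve
  have hd : ∀ t ∈ Icc (0 : ℝ) 1, HasDerivWithinAt (fun t => V t * c' t)
      (-((V t * c' t) * (V t * c' t)ᴴ * V t)) (Icc 0 1) t := by
    intro t ht
    have h2 := hasDerivWithinAt_matMul (hV.deriv t ht) (hc.deriv₂ t ht)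
    have hcomm : c t * (c' t * c' t) = c' t * c' t * c t := by
      have e1 : c t * c' t = c' t - c' t * c t := eq_sub_of_add_eq' (hp.deriv_eq ht)
      have e2 : c' t * c t = c' t - c t * c' t := eq_sub_of_add_eq (hp.deriv_eq ht)
      rw [← Matrix.mul_assoc, e1, Matrix.sub_mul, Matrix.mul_assoc, Matrix.mul_assoc, e2,
        Matrix.mul_sub]
    have hfix : (V t * c' t * c' t + V t * c'' t) * c t = V t * c' t * c' t + V t * c'' t := by
      have e1 : V t * c' t * c' t * c t = V t * c' t * c' t := by
        calc V t * c' t * c' t * c t = V t * (c' t * c' t * c t) := by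
              simp only [Matrix.mul_assoc]
          _ = V t * c t * (c' t * c' t) := by rw [← hcomm, Matrix.mul_assoc]
          _ = _ := by rw [hV.mul_proj ht, Matrix.mul_assoc]
      have e2 : V t * c'' t * c t = V t * c'' t := by
        calc V t * c'' t * c t = V t * c t * c'' t * c t := by rw [hV.mul_proj ht]
          _ = V t * (c t * c'' t * c t) := by simp only [Matrix.mul_assoc]
          _ = V t * c t * c'' t := by rw [hc.normal t ht, Matrix.mul_assoc]
          _ = _ := by rw [hV.mul_proj ht]
      rw [Matrix.add_mul, e1, e2]
    have hz := hasDerivWithinAt_matMul h2 (hasDerivWithinAt_conjTranspose (hV.deriv t ht))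
    have hz' : (V t * c' t * c' t + V t * c'' t) * (V t)ᴴ + (V t * c' t) * (V t * c' t)ᴴ = 0 :=
      hasDerivWithinAt_unique ht hz (hasDerivWithinAt_congr (hasDerivWithinAt_const 0 _ _)
        (fun s hs => hV.mul_deriv_mul_conjTranspose hp hs) ht)
    convert h2 using 1
    rw [← hfix, ← hV.proj t ht, ← Matrix.mul_assoc, eq_neg_of_add_eq_zero_left hz',
      Matrix.neg_mul]
  have hconst : (V t * c' t) * (V t * c' t)ᴴ = (V 0 * c' 0) * (V 0 * c' 0)ᴴ := by
    refine eq_of_hasDerivWithinAt_zero (D := fun t => (V t * c' t) * (V t * c' t)ᴴ)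
      (fun t ht => ?_) ht
    have h0 : V t * (V t * c' t)ᴴ = 0 := by
      have := congrArg conjTranspose (hV.mul_deriv_mul_conjTranspose hp ht)
      rwa [conjTranspose_mul, conjTranspose_conjTranspose, conjTranspose_zero] at this
    convert hasDerivWithinAt_matMul (hd t ht) (hasDerivWithinAt_conjTranspose (hd t ht)) using 1
    rw [Matrix.neg_mul, Matrix.mul_assoc _ (V t), h0, conjTranspose_neg,
      conjTranspose_mul (V t * c' t * (V t * c' t)ᴴ), Matrix.mul_neg, ← Matrix.mul_assoc (V t * c' t), hV.mul_deriv_mul_conjTranspose hp ht]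
    simp
  rw [← hconst]
  exact hd t ht

theorem frame_eq (hc : IsProjGeodesic c c' c'') (hV : IsParallelFrame c c' V) :
    ∃ (Q : Matrix ι ι ℂ) (b : ι → ℝ), Q * Qᴴ = 1 ∧ ∀ t ∈ Icc (0 : ℝ) 1,
      V t = Q * diagonal (fun i => ((Real.cos (b i * t) : ℝ) : ℂ)) * Qᴴ * V 0
        + Q * diagonal (fun i => ((sinScaled (b i) t : ℝ) : ℂ)) * Qᴴ * (V 0 * c' 0) :=
  matrix_harmonic_oscillator (V' := fun t => V t * c' t) hV.deriv
    fun _ ht => hc.hasDerivWithinAt_frame_deriv hV ht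

/-- The frame at time `t` of a geodesic makes with the initial one a Gram matrix of real
determinant (the product of the cosines of the principal angles). -/
theorem det_frame_mul_frame_zero (hc : IsProjGeodesic c c' c'') (hV : IsParallelFrame c c' V)
    {t : ℝ} (ht : t ∈ Icc (0 : ℝ) 1) : ∃ r : ℝ, (V t * (V 0)ᴴ).det = r := by
  obtain ⟨Q, b, hQ, h⟩ := hc.frame_eq hV
  have h0 : (0 : ℝ) ∈ Icc (0 : ℝ) 1 := by simp
  refine ⟨∏ i, Real.cos (b i * t), ?_⟩
  -- The sine term drops out because the initial velocity of a parallel frame is orthogonal to the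
  -- frame.
  have e : V t * (V 0)ᴴ = Q * diagonal (fun i => ((Real.cos (b i * t) : ℝ) : ℂ)) * Qᴴ := by
    rw [h t ht, Matrix.add_mul, Matrix.mul_assoc _ (V 0), hV.orth 0 h0, Matrix.mul_one,
      Matrix.mul_assoc _ (V 0 * c' 0), hV.mul_deriv_mul_conjTranspose hc.toIsProjCurve h0,
      Matrix.mul_zero, add_zero]
  rw [e, det_mul, det_mul, mul_right_comm, ← det_mul, hQ, det_one, one_mul, det_diagonal]
  push_cast
  rfl

-- The closed form of the frame makes sense for every real t and is analytic there. This is used to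
-- isolate the exceptional times on the side zz'.
open scoped ContDiff in
theorem det_frame_mul_analytic (hc : IsProjGeodesic c c' c'') (hV : IsParallelFrame c c' V)
    (M : Matrix κ ι ℂ) :
    ∃ f : ℝ → ℂ, AnalyticOnNhd ℝ f univ ∧ ∀ t ∈ Icc (0 : ℝ) 1, (V t * M).det = f t := by
  obtain ⟨Q, b, -, h⟩ := hc.frame_eq hV
  have hdiag : ∀ g : ι → ℝ → ℝ, (∀ i, ContDiff ℝ ω (g i)) →
      ∀ i j, ContDiff ℝ ω fun t => (Q * diagonal fun i => ((g i t : ℝ) : ℂ)) i j := by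
    intro g hg i j
    simp only [mul_diagonal]
    exact contDiff_const.mul (Complex.ofRealCLM.contDiff.comp (hg j))
  refine ⟨fun t => ((Q * diagonal (fun i => ((Real.cos (b i * t) : ℝ) : ℂ)) * Qᴴ * V 0
        + Q * diagonal (fun i => ((sinScaled (b i) t : ℝ) : ℂ)) * Qᴴ * (V 0 * c' 0)) * M).det,
      ?_, fun t ht => by rw [h t ht]⟩
  refine ContDiff.analyticOnNhd ?_
  simp only [det_apply]
  refine ContDiff.sum fun p _ => ContDiff.const_smul _ (contDiff_prod fun i _ => ?_)
  refine contDiff_mul_const_apply (fun i j => ContDiff.add ?_ ?_) _ _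
  · exact contDiff_mul_const_apply (contDiff_mul_const_apply (hdiag _ fun i => Real.contDiff_cos.comp (contDiff_const.mul contDiff_id)))
      i j
  · exact contDiff_mul_const_apply (contDiff_mul_const_apply (hdiag _ fun i => contDiff_sinScaled (b i))) i j

end IsProjGeodesic

end

/-! ### Determinants, the connection form and its curvature -/

noncomputable section

open Set Filter Topology MeasureTheory

open Matrix

theorem hasDerivWithinAt_integral_of_continuousOn {E : Type*} [NormedAddCommGroup E]
    [NormedSpace ℝ E] [CompleteSpace E] {f : ℝ → E} (hf : ContinuousOn f (Icc 0 1)) {t : ℝ}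
    (ht : t ∈ Icc (0 : ℝ) 1) :
    HasDerivWithinAt (fun t => ∫ τ in (0 : ℝ)..t, f τ) (f t) (Icc 0 1) t := by
  set F : ℝ → E := fun t => f (projIcc 0 1 zero_le_one t) with hF
  have hFc : Continuous F := hf.comp_continuous
    (continuous_subtype_val.comp continuous_projIcc) fun s => (projIcc 0 1 zero_le_one s).2
  have hFf : ∀ t ∈ Icc (0 : ℝ) 1, F t = f t := fun t ht => by
    simp [hF, projIcc_of_mem zero_le_one ht]
  have h := intervalIntegral.integral_hasDerivAt_right (hFc.intervalIntegrable 0 t)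
    (hFc.stronglyMeasurableAtFilter _ _) hFc.continuousAt
  rw [hFf t ht] at h
  refine h.hasDerivWithinAt.congr_of_mem (fun τ hτ => ?_) ht
  refine intervalIntegral.integral_congr fun x hx => (hFf x ?_).symm
  rw [uIcc_of_le hτ.1] at hx
  exact ⟨hx.1, hx.2.trans hτ.2⟩

namespace Matrix

theorem hasDerivWithinAt_det_of_eq_one {ι : Type*} [Fintype ι] [DecidableEq ι]
    {h : ℝ → Matrix ι ι ℂ} {B : Matrix ι ι ℂ} {S : Set ℝ} {t : ℝ}
    (hh : HasDerivWithinAt h B S t) (h1 : h t = 1) :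
    HasDerivWithinAt (fun s => (h s).det) B.trace S t := by
  have key : ∀ {h : ℝ → Matrix ι ι ℂ} {S : Set ℝ} {t : ℝ}, HasDerivWithinAt h B S t → h t = 1 →
      HasDerivWithinAt (fun s => (h s).det) (∑ p : Equiv.Perm ι, Equiv.Perm.sign p •
        ∑ i, (∏ j ∈ Finset.univ.erase i, (1 : Matrix ι ι ℂ) (p j) j) • B (p i) i) S t := by
    intro h S t hh h1
    simp only [det_apply]
    refine HasDerivWithinAt.fun_sum fun p _ => HasDerivWithinAt.const_smul _ ?_
    rw [← h1]
    exact HasDerivWithinAt.fun_finsetProd fun i _ => hasDerivWithinAt_iff.1 hh (p i) i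
  have e := key hh h1
  have hline : HasDerivWithinAt (fun r : ℝ => (1 : Matrix ι ι ℂ) + (r : ℂ) • B) B univ 0 := by
    refine hasDerivWithinAt_iff.2 fun i j => HasDerivAt.hasDerivWithinAt ?_
    simpa using ((hasDerivAt_id (0 : ℝ)).ofReal_comp.mul_const (B i j)).const_add
      ((1 : Matrix ι ι ℂ) i j)
  have e' := key hline (by simp)
  have htr : HasDerivAt (fun r : ℝ => ((1 : Matrix ι ι ℂ) + (r : ℂ) • B).det) B.trace 0 := by
    rw [funext fun r : ℝ => det_one_add_smul (r : ℂ) B]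
    have h2 : HasDerivAt (fun r : ℂ => 1 + B.trace * r + Polynomial.eval r
        (1 + (Polynomial.X : Polynomial ℂ) • B.map Polynomial.C).det.divX.divX * r ^ 2)
        B.trace ((0 : ℝ) : ℂ) := by
      have := (((hasDerivAt_id' ((0 : ℝ) : ℂ)).const_mul B.trace).const_add 1).fun_add
        (((1 + (Polynomial.X : Polynomial ℂ) • B.map Polynomial.C).det.divX.divX.hasDerivAt
          ((0 : ℝ) : ℂ)).fun_mul ((hasDerivAt_id' ((0 : ℝ) : ℂ)).fun_pow 2))
      simpa using this
    exact h2.comp_ofReal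
  rw [hasDerivWithinAt_univ] at e'
  rwa [e'.unique htr] at e

/-- Left translation by the inverse of `g t` reduces Jacobi's formula to the identity matrix. -/
theorem hasDerivWithinAt_det {ι : Type*} [Fintype ι] [DecidableEq ι]
    {g : ℝ → Matrix ι ι ℂ} {B : Matrix ι ι ℂ} {S : Set ℝ} {t : ℝ}
    (hg : HasDerivWithinAt g (g t * B) S t) (hu : IsUnit (g t).det) :
    HasDerivWithinAt (fun s => (g s).det) ((g t).det * B.trace) S t := by
  have h := hasDerivWithinAt_const_mul (g t)⁻¹ hg
  rw [← Matrix.mul_assoc, nonsing_inv_mul _ hu, Matrix.one_mul] at h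
  have h2 := (hasDerivWithinAt_det_of_eq_one h (nonsing_inv_mul _ hu)).const_mul (g t).det
  refine h2.congr_of_eventuallyEq (Eventually.of_forall fun s => ?_) ?_ <;>
  · simp only [← det_mul, ← Matrix.mul_assoc, mul_nonsing_inv _ hu, Matrix.one_mul]

theorem continuousOn_iff_entries {X ι κ : Type*} [TopologicalSpace X] {A : X → Matrix ι κ ℂ}
    {S : Set X} : ContinuousOn A S ↔ ∀ i j, ContinuousOn (fun x => A x i j) S :=
  continuousOn_pi.trans (forall_congr' fun _ => continuousOn_pi)

theorem continuousOn_matMul {X ι κ μ : Type*} [TopologicalSpace X] [Fintype κ]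
    {A : X → Matrix ι κ ℂ} {B : X → Matrix κ μ ℂ} {S : Set X} (hA : ContinuousOn A S)
    (hB : ContinuousOn B S) : ContinuousOn (fun x => A x * B x) S := by
  refine continuousOn_iff_entries.2 fun i j => ?_
  simp only [Matrix.mul_apply]
  exact continuousOn_finsetSum _ fun k _ =>
    (continuousOn_iff_entries.1 hA i k).mul (continuousOn_iff_entries.1 hB k j)

theorem continuousOn_conjTranspose {X ι κ : Type*} [TopologicalSpace X]
    {A : X → Matrix ι κ ℂ} {S : Set X} (hA : ContinuousOn A S) :
    ContinuousOn (fun x => (A x)ᴴ) S :=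
  continuousOn_iff_entries.2 fun i j => (continuousOn_iff_entries.1 hA j i).star

theorem continuousOn_trace {X ι : Type*} [TopologicalSpace X] [Fintype ι]
    {A : X → Matrix ι ι ℂ} {S : Set X} (hA : ContinuousOn A S) :
    ContinuousOn (fun x => (A x).trace) S :=
  continuousOn_finsetSum _ fun i _ => continuousOn_iff_entries.1 hA i i

theorem continuousOn_det {X ι : Type*} [TopologicalSpace X] [Fintype ι] [DecidableEq ι]
    {A : X → Matrix ι ι ℂ} {S : Set X} (hA : ContinuousOn A S) :
    ContinuousOn (fun x => (A x).det) S :=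
  (Continuous.matrix_det (continuous_id (X := Matrix ι ι ℂ))).comp_continuousOn hA

theorem continuousOn_of_hasDerivWithinAt {ι κ : Type*} [Finite ι] [Finite κ]
    {A A' : ℝ → Matrix ι κ ℂ} {S : Set ℝ} (h : ∀ t ∈ S, HasDerivWithinAt A (A' t) S t) :
    ContinuousOn A S :=
  continuousOn_iff_entries.2 fun i j t ht =>
    (hasDerivWithinAt_iff.1 (h t ht) i j).continuousWithinAt

end Matrix

variable {ι κ : Type*} [Fintype ι] [DecidableEq ι] [Fintype κ]

theorem deriv_mul_conjTranspose_add {U T : ℝ → Matrix ι κ ℂ}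
    (hU : ∀ t ∈ Icc (0 : ℝ) 1, HasDerivWithinAt U (T t) (Icc 0 1) t)
    (h1 : ∀ t ∈ Icc (0 : ℝ) 1, U t * (U t)ᴴ = 1) {t : ℝ} (ht : t ∈ Icc (0 : ℝ) 1) :
    T t * (U t)ᴴ + U t * (T t)ᴴ = 0 := by
  have hd := hasDerivWithinAt_matMul (hU t ht) (hasDerivWithinAt_conjTranspose (hU t ht))
  have hconst : HasDerivWithinAt (fun t => U t * (U t)ᴴ) 0 (Icc 0 1) t :=
    hasDerivWithinAt_congr (Matrix.hasDerivWithinAt_const 1 _ _) h1 ht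
  exact hasDerivWithinAt_unique ht hd hconst

/-- Comparison of a parallel frame with an arbitrary orthonormal frame `U` of the same curve: the
determinant of the change of frame is the exponential of the integral of the connection form. -/
theorem IsParallelFrame.det_mul_conjTranspose {c c' : ℝ → Matrix κ κ ℂ}
    {V U T : ℝ → Matrix ι κ ℂ} (hc : IsProjCurve c c') (hV : IsParallelFrame c c' V)
    (hU : ∀ t ∈ Icc (0 : ℝ) 1, HasDerivWithinAt U (T t) (Icc 0 1) t)
    (hT : ContinuousOn T (Icc 0 1))
    (h1 : ∀ t ∈ Icc (0 : ℝ) 1, U t * (U t)ᴴ = 1)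
    (h2 : ∀ t ∈ Icc (0 : ℝ) 1, (U t)ᴴ * U t = c t) (h0 : V 0 = U 0)
    {t : ℝ} (ht : t ∈ Icc (0 : ℝ) 1) :
    (V t * (U t)ᴴ).det = Complex.exp (-∫ τ in (0 : ℝ)..t, (T τ * (U τ)ᴴ).trace) := by
  have hUc : ContinuousOn U (Icc 0 1) := continuousOn_of_hasDerivWithinAt hU
  have hα : ContinuousOn (fun t => (T t * (U t)ᴴ).trace) (Icc 0 1) :=
    continuousOn_trace (continuousOn_matMul hT (continuousOn_conjTranspose hUc))
  have hunit : ∀ t ∈ Icc (0 : ℝ) 1, IsUnit (V t * (U t)ᴴ).det := by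
    intro t ht
    refine (Matrix.isUnit_iff_isUnit_det _).1 (IsUnit.of_mul_eq_one (U t * (V t)ᴴ) ?_)
    rw [Matrix.mul_assoc, ← Matrix.mul_assoc (U t)ᴴ, h2 t ht, ← Matrix.mul_assoc,
      hV.mul_proj ht, hV.orth t ht]
  have hd : ∀ t ∈ Icc (0 : ℝ) 1, HasDerivWithinAt (fun t => V t * (U t)ᴴ)
      ((V t * (U t)ᴴ) * -(T t * (U t)ᴴ)) (Icc 0 1) t := by
    intro t ht
    convert hasDerivWithinAt_matMul (hV.deriv t ht) (hasDerivWithinAt_conjTranspose (hU t ht))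
      using 1
    -- Both frames span the same space, so U⁺ factors through V⁺: parallelism kills the V' term, and
    -- the U' term gives the connection form with a minus sign.
    have hUV : (U t)ᴴ = (V t)ᴴ * (V t * (U t)ᴴ) := by
      rw [← Matrix.mul_assoc, hV.proj t ht, ← h2 t ht, Matrix.mul_assoc, h1 t ht, Matrix.mul_one]
    have e1 : V t * c' t * (U t)ᴴ = 0 := by
      rw [hUV, ← Matrix.mul_assoc, hV.mul_deriv_mul_conjTranspose hc ht, Matrix.zero_mul]
    have e2 : V t * (T t)ᴴ = V t * (U t)ᴴ * (U t * (T t)ᴴ) := by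
      rw [Matrix.mul_assoc, ← Matrix.mul_assoc (U t)ᴴ, h2 t ht, ← Matrix.mul_assoc,
        hV.mul_proj ht]
    rw [e1, zero_add, e2, eq_neg_of_add_eq_zero_right (deriv_mul_conjTranspose_add hU h1 ht)]
  have hconst := constant_of_derivWithin_zero (a := (0 : ℝ)) (b := 1)
    (f := fun t => (V t * (U t)ᴴ).det * Complex.exp (∫ τ in (0 : ℝ)..t, (T τ * (U τ)ᴴ).trace))
  have hder : ∀ t ∈ Icc (0 : ℝ) 1, HasDerivWithinAt
      (fun t => (V t * (U t)ᴴ).det * Complex.exp (∫ τ in (0 : ℝ)..t, (T τ * (U τ)ᴴ).trace))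
      0 (Icc 0 1) t := by
    intro t ht
    refine ((hasDerivWithinAt_det (hd t ht) (hunit t ht)).mul
      (hasDerivWithinAt_integral_of_continuousOn hα ht).cexp).congr_deriv ?_
    rw [trace_neg]
    ring
  have := hconst (fun t ht => (hder t ht).differentiableWithinAt)
      (fun t ht => (hder t (Ico_subset_Icc_self ht)).derivWithin
        (uniqueDiffOn_Icc zero_lt_one t (Ico_subset_Icc_self ht))) t ht
  simp only [intervalIntegral.integral_same, Complex.exp_zero, mul_one, h0,
    h1 0 (by simp), det_one] at this
  rw [Complex.exp_neg]
  exact eq_inv_of_mul_eq_one_left this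

/-- A surface of orthogonal projections over the unit square, with partial velocities `A` and `B` in
the first and in the second variable and mixed derivative `A'`. -/
structure IsProjSurface (P A B A' : ℝ → ℝ → Matrix κ κ ℂ) : Prop where
  herm : ∀ s ∈ Icc (0 : ℝ) 1, ∀ t ∈ Icc (0 : ℝ) 1, (P s t)ᴴ = P s t
  idem : ∀ s ∈ Icc (0 : ℝ) 1, ∀ t ∈ Icc (0 : ℝ) 1, P s t * P s t = P s t
  deriv_fst : ∀ s ∈ Icc (0 : ℝ) 1, ∀ t ∈ Icc (0 : ℝ) 1,
    HasDerivWithinAt (fun s => P s t) (A s t) (Icc 0 1) s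
  deriv_snd : ∀ s ∈ Icc (0 : ℝ) 1, ∀ t ∈ Icc (0 : ℝ) 1,
    HasDerivWithinAt (P s) (B s t) (Icc 0 1) t
  deriv_mixed : ∀ s ∈ Icc (0 : ℝ) 1, ∀ t ∈ Icc (0 : ℝ) 1,
    HasDerivWithinAt (A s) (A' s t) (Icc 0 1) t
  cont : ContinuousOn (Function.uncurry A) (Icc 0 1 ×ˢ Icc 0 1)
  cont_snd : ContinuousOn (Function.uncurry B) (Icc 0 1 ×ˢ Icc 0 1)
  cont_mixed : ContinuousOn (Function.uncurry A') (Icc 0 1 ×ˢ Icc 0 1)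

namespace IsProjSurface

variable {P A B A' : ℝ → ℝ → Matrix κ κ ℂ}

theorem isProjCurve_fst (h : IsProjSurface P A B A') {t : ℝ} (ht : t ∈ Icc (0 : ℝ) 1) :
    IsProjCurve (fun s => P s t) (fun s => A s t) where
  herm s hs := h.herm s hs t ht
  idem s hs := h.idem s hs t ht
  deriv s hs := h.deriv_fst s hs t ht
  cont := h.cont.comp (f := fun s : ℝ => (s, t)) (by fun_prop) fun _ hs => ⟨hs, ht⟩

/-- The orthonormal frame of the surface that is parallel along the first variable; the integral of
its curvature is the connection form on the edge `s = 1`. -/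
theorem exists_radial_frame [DecidableEq κ] (h : IsProjSurface P A B A') {E : Matrix ι κ ℂ}
    (hE : E * Eᴴ = 1) (hE' : ∀ t ∈ Icc (0 : ℝ) 1, Eᴴ * E = P 0 t) :
    ∃ U T : ℝ → ℝ → Matrix ι κ ℂ,
      (∀ t ∈ Icc (0 : ℝ) 1, U 0 t = E) ∧
      (∀ t ∈ Icc (0 : ℝ) 1, IsParallelFrame (fun s => P s t) (fun s => A s t) fun s => U s t) ∧
      (∀ s ∈ Icc (0 : ℝ) 1, ∀ t ∈ Icc (0 : ℝ) 1,
        HasDerivWithinAt (U s) (T s t) (Icc 0 1) t) ∧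
      ContinuousOn (Function.uncurry U) (Icc 0 1 ×ˢ Icc 0 1) ∧
      ContinuousOn (Function.uncurry T) (Icc 0 1 ×ˢ Icc 0 1) ∧
      ∀ t ∈ Icc (0 : ℝ) 1,
        ∫ s in (0 : ℝ)..1, (Complex.I / 2 * (P s t * (B s t * A s t - A s t * B s t)).trace).re
          = (Complex.I / 2 * (T 1 t * (U 1 t)ᴴ).trace).re := by
  obtain ⟨W, T, hW0, hT0, hWc, hTc, hWT⟩ :
      ∃ W T : ℝ → ℝ → Matrix κ κ ℂ,
      (∀ t ∈ Icc (0 : ℝ) 1, W 0 t = 1) ∧ (∀ t ∈ Icc (0 : ℝ) 1, T 0 t = 0) ∧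
      ContinuousOn (Function.uncurry W) (Icc 0 1 ×ˢ Icc 0 1) ∧
      ContinuousOn (Function.uncurry T) (Icc 0 1 ×ˢ Icc 0 1) ∧
      ∀ s ∈ Icc (0 : ℝ) 1, ∀ t ∈ Icc (0 : ℝ) 1,
        HasDerivWithinAt (fun s => W s t) (W s t * A s t) (Icc 0 1) s ∧
        HasDerivWithinAt (W s) (T s t) (Icc 0 1) t ∧
        HasDerivWithinAt (fun s => T s t) (T s t * A s t + W s t * A' s t) (Icc 0 1) s := by
    let := Matrix.linftyOpNormedRing (n := κ) (α := ℂ)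
    let := Matrix.linftyOpNormedAlgebra (n := κ) (α := ℂ) (R := ℝ)
    exact exists_parametric_transport h.cont h.cont_mixed h.deriv_mixed
  have hpar : ∀ t ∈ Icc (0 : ℝ) 1,
      IsParallelFrame (fun s => P s t) (fun s => A s t) fun s => E * W s t := by
    intro t ht
    refine .of_hasDerivWithinAt (h.isProjCurve_fst ht) (fun s hs => ?_) ?_ ?_
    · rw [Matrix.mul_assoc]
      exact hasDerivWithinAt_const_mul E (hWT s hs t ht).1
    · simpa [hW0 t ht] using hE
    · simpa [hW0 t ht] using hE' t ht
  have hder : ∀ s ∈ Icc (0 : ℝ) 1, ∀ t ∈ Icc (0 : ℝ) 1,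
      HasDerivWithinAt (fun t => E * W s t) (E * T s t) (Icc 0 1) t := fun s hs t ht =>
    hasDerivWithinAt_const_mul E (hWT s hs t ht).2.1
  have hUc := continuousOn_matMul (continuousOn_const (c := E)) hWc
  have hTc' := continuousOn_matMul (continuousOn_const (c := E)) hTc
  refine ⟨fun s t => E * W s t, fun s t => E * T s t, fun t ht => by simp [hW0 t ht], hpar, hder,
    hUc, hTc', fun t ht => ?_⟩
  -- The structure equation: the s-derivative of the connection form is the curvature.
  have hαd : ∀ s ∈ Icc (0 : ℝ) 1, HasDerivWithinAt
      (fun s => (Complex.I / 2 * ((E * T s t) * (E * W s t)ᴴ).trace).re)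
      (Complex.I / 2 * (P s t * (B s t * A s t - A s t * B s t)).trace).re (Icc 0 1) s := by
    intro s hs
    have hp := hpar t ht
    have e0 := hasDerivWithinAt_trace (hasDerivWithinAt_matMul
      (hasDerivWithinAt_const_mul E (hWT s hs t ht).2.2)
      (hasDerivWithinAt_conjTranspose (hp.deriv s hs)))
    have e1 := (Complex.reCLM.hasFDerivAt.comp_hasDerivWithinAt s (e0.const_mul (Complex.I / 2)))
    refine e1.congr_deriv ?_
    rw [Complex.reCLM_apply]
    congr 2
    have hAh : (A s t)ᴴ = A s t := (h.isProjCurve_fst ht).deriv_herm hs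
    set U := E * W s t with hU
    set D := E * T s t with hD
    have hUU : U * Uᴴ = 1 := hp.orth s hs
    have hUP : Uᴴ * U = P s t := hp.proj s hs
    have hzero : ∀ τ ∈ Icc (0 : ℝ) 1, E * W s τ * A s τ * (E * W s τ)ᴴ = 0 := fun τ hτ =>
      (hpar τ hτ).mul_deriv_mul_conjTranspose (h.isProjCurve_fst hτ) hs
    -- Differentiating the parallelism condition U A U⁺ = 0 in t eliminates the mixed derivative A'.
    have hz : (D * A s t + U * A' s t) * Uᴴ + U * A s t * Dᴴ = 0 := by
      have hd := hasDerivWithinAt_matMul (hasDerivWithinAt_matMul (hder s hs t ht)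
        (h.deriv_mixed s hs t ht)) (hasDerivWithinAt_conjTranspose (hder s hs t ht))
      have hd' : HasDerivWithinAt (fun τ => E * W s τ * A s τ * (E * W s τ)ᴴ) 0 (Icc 0 1) t :=
        hasDerivWithinAt_congr (Matrix.hasDerivWithinAt_const 0 _ _) hzero ht
      exact hasDerivWithinAt_unique ht hd hd'
    have hB : B s t = Dᴴ * U + Uᴴ * D := by
      have hd := hasDerivWithinAt_matMul
        (hasDerivWithinAt_conjTranspose (hder s hs t ht)) (hder s hs t ht)
      have hd' := hasDerivWithinAt_congr (B := P s) hd
        (fun τ hτ => ((hpar τ hτ).proj s hs).symm) ht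
      exact hasDerivWithinAt_unique ht (h.deriv_snd s hs t ht) hd'
    have hz0 : U * A s t * Uᴴ = 0 := hzero t ht
    have hL : (E * (T s t * A s t + W s t * A' s t)) * Uᴴ + D * (U * A s t)ᴴ
        = D * A s t * Uᴴ - U * A s t * Dᴴ := by
      have : E * (T s t * A s t + W s t * A' s t) = D * A s t + U * A' s t := by
        simp only [hU, hD, Matrix.mul_add, Matrix.mul_assoc]
      rw [this, eq_neg_of_add_eq_zero_left hz, conjTranspose_mul U, hAh, ← Matrix.mul_assoc]
      abel
    have hR : (P s t * (B s t * A s t - A s t * B s t)).trace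
        = (U * (B s t * A s t - A s t * B s t) * Uᴴ).trace := by
      rw [← hUP, Matrix.mul_assoc, trace_mul_comm]
    rw [hL, hR, hB]
    have e2 : U * ((Dᴴ * U + Uᴴ * D) * A s t - A s t * (Dᴴ * U + Uᴴ * D)) * Uᴴ
        = U * Dᴴ * (U * A s t * Uᴴ) + (U * Uᴴ) * D * A s t * Uᴴ
          - (U * A s t * Dᴴ * (U * Uᴴ) + (U * A s t * Uᴴ) * D * Uᴴ) := by
      simp only [Matrix.mul_add, Matrix.add_mul, Matrix.mul_sub, Matrix.sub_mul, Matrix.mul_assoc]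
    rw [e2, hz0, hUU]
    simp
  have hcont : ContinuousOn (fun s =>
      (Complex.I / 2 * (P s t * (B s t * A s t - A s t * B s t)).trace).re) (Icc 0 1) := by
    have hp := h.isProjCurve_fst ht
    have hP : ContinuousOn (fun s => P s t) (Icc 0 1) := continuousOn_of_hasDerivWithinAt hp.deriv
    have hB : ContinuousOn (fun s => B s t) (Icc 0 1) :=
      h.cont_snd.comp (f := fun s : ℝ => (s, t)) (by fun_prop) fun _ hs => ⟨hs, ht⟩
    exact Complex.continuous_re.comp_continuousOn (continuousOn_const.mul (continuousOn_trace
      (continuousOn_matMul hP ((continuousOn_matMul hB hp.cont).sub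
        (continuousOn_matMul hp.cont hB)))))
  rw [intervalIntegral.integral_eq_sub_of_hasDeriv_right (a := 0) (b := 1)
    (f := fun s => (Complex.I / 2 * ((E * T s t) * (E * W s t)ᴴ).trace).re)
    (by rw [uIcc_of_le zero_le_one]; exact fun s hs => (hαd s hs).continuousWithinAt)
    (fun s hs => ?_) ?_]
  -- There is no contribution from s = 0, where the frame does not depend on t.
  · simp [hT0 t ht]
  · refine ContinuousOn.intervalIntegrable ?_
    rwa [uIcc_of_le zero_le_one]
  · rw [min_eq_left zero_le_one, max_eq_right zero_le_one] at hs
    exact ((hαd s (Ioo_subset_Icc_self hs)).hasDerivAt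
      (Icc_mem_nhds hs.1 hs.2)).hasDerivWithinAt

end IsProjSurface

end

/-! ### From the geodesics and surfaces of the statement to curves and surfaces of projections -/

noncomputable section

open Set Filter Topology MeasureTheory

open Matrix

theorem hasDerivWithinAt_fst_of_contDiffOn {f : ℝ × ℝ → ℂ} {k : WithTop ℕ∞} (hk : k ≠ 0)
    (hf : ContDiffOn ℝ k f (Icc 0 1 ×ˢ Icc 0 1)) {s t : ℝ} (hs : s ∈ Icc (0 : ℝ) 1)
    (ht : t ∈ Icc (0 : ℝ) 1) :
    HasDerivWithinAt (fun s => f (s, t))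
      (fderivWithin ℝ f (Icc 0 1 ×ˢ Icc 0 1) (s, t) (1, 0)) (Icc 0 1) s :=
  ((hf.differentiableOn hk (s, t) ⟨hs, ht⟩).hasFDerivWithinAt).comp_hasDerivWithinAt
    (f := fun s : ℝ => (s, t)) s
    ((hasDerivWithinAt_id s _).prodMk (hasDerivWithinAt_const s _ t)) fun _ h => ⟨h, ht⟩

theorem hasDerivWithinAt_snd_of_contDiffOn {f : ℝ × ℝ → ℂ} {k : WithTop ℕ∞} (hk : k ≠ 0)
    (hf : ContDiffOn ℝ k f (Icc 0 1 ×ˢ Icc 0 1)) {s t : ℝ} (hs : s ∈ Icc (0 : ℝ) 1)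
    (ht : t ∈ Icc (0 : ℝ) 1) :
    HasDerivWithinAt (fun t => f (s, t))
      (fderivWithin ℝ f (Icc 0 1 ×ˢ Icc 0 1) (s, t) (0, 1)) (Icc 0 1) t :=
  ((hf.differentiableOn hk (s, t) ⟨hs, ht⟩).hasFDerivWithinAt).comp_hasDerivWithinAt
    (f := fun t : ℝ => (s, t)) t
    ((hasDerivWithinAt_const t _ s).prodMk (hasDerivWithinAt_id t _)) fun _ h => ⟨hs, h⟩

theorem contDiffOn_fderivWithin_square {f : ℝ × ℝ → ℂ} {k l : WithTop ℕ∞}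
    (hf : ContDiffOn ℝ k f (Icc 0 1 ×ˢ Icc 0 1)) (hkl : l + 1 ≤ k) (v : ℝ × ℝ) :
    ContDiffOn ℝ l (fun p => fderivWithin ℝ f (Icc 0 1 ×ˢ Icc 0 1) p v)
      (Icc 0 1 ×ˢ Icc 0 1) :=
  (hf.fderivWithin ((uniqueDiffOn_Icc zero_lt_one).prod (uniqueDiffOn_Icc zero_lt_one))
    hkl).clm_apply contDiffOn_const

open scoped ComplexOrder in
/-- A Hermitian matrix that is orthogonal to the tangent space at `P` commutes with `P`. -/
theorem mul_mul_eq_of_trace_eq_zero {κ : Type*} [Fintype κ] {P a : Matrix κ κ ℂ}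
    (hP : Pᴴ = P) (hPP : P * P = P) (ha : aᴴ = a)
    (h : ∀ X : Matrix κ κ ℂ, X.IsHermitian → P * X + X * P = X → (a * X).trace = 0) :
    P * a * P = P * a := by
  -- M is the off-diagonal block of a. Testing a against the tangent vector M + M⁺ gives twice the
  -- squared norm of M.
  set M := P * a - P * a * P with hM
  have hMh : Mᴴ = a * P - P * a * P := by
    simp only [hM, conjTranspose_sub, conjTranspose_mul, hP, ha, Matrix.mul_assoc]
  have hPM : P * M = M := by
    simp only [hM, Matrix.mul_sub, ← Matrix.mul_assoc, hPP]
  have hMP : M * P = 0 := by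
    simp only [hM, Matrix.sub_mul, Matrix.mul_assoc, hPP, sub_self]
  have hPMh : P * Mᴴ = 0 := by
    have := congrArg conjTranspose hMP
    rwa [conjTranspose_mul, hP, conjTranspose_zero] at this
  have hMhP : Mᴴ * P = Mᴴ := by
    have := congrArg conjTranspose hPM
    rwa [conjTranspose_mul, hP] at this
  have h0 := h (M + Mᴴ) (by simp [IsHermitian, add_comm]) (by
    rw [Matrix.mul_add, Matrix.add_mul, hPM, hMP, hPMh, hMhP]; simp)
  have e1 : (a * M).trace = (Mᴴ * M).trace := by
    have : Mᴴ * M = a * M - P * (a * M) := by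
      rw [hMh, Matrix.sub_mul, Matrix.mul_assoc, Matrix.mul_assoc, hPM, Matrix.mul_assoc]
    have h2 : (P * (a * M)).trace = 0 := by
      rw [trace_mul_comm, Matrix.mul_assoc, hMP]; simp
    rw [this, trace_sub, h2, sub_zero]
  have e2 : (a * Mᴴ).trace = (Mᴴ * M).trace := by
    have : M * Mᴴ = P * (a * Mᴴ) := by
      rw [hM, Matrix.sub_mul, Matrix.mul_assoc (P * a), ← hM, hPMh]
      simp [Matrix.mul_assoc]
    rw [trace_mul_comm Mᴴ, this, trace_mul_comm P, Matrix.mul_assoc, hMhP]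
  rw [Matrix.mul_add, trace_add, e1, e2] at h0
  have h3 : (Mᴴ * M).trace = 0 := by
    rw [← two_mul] at h0
    exact (mul_eq_zero.1 h0).resolve_left two_ne_zero
  exact (sub_eq_zero.1 (trace_conjTranspose_mul_self_eq_zero_iff.1 h3)).symm

namespace CGrass

theorem hasDerivWithinAt_velocity {a b : Type*} [Finite a] [Finite b] {c : ℝ → Matrix a b ℂ}
    {t : ℝ} (h : ∀ i j, DifferentiableWithinAt ℝ (fun s => c s i j) (Icc 0 1) t) :
    HasDerivWithinAt c (velocity c t) (Icc 0 1) t :=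
  hasDerivWithinAt_iff.2 fun i j => (h i j).hasDerivWithinAt

theorem IsGeodesic.isProjGeodesic {n m : ℕ} {c : ℝ → Matrix (Fin n ⊕ Fin m) (Fin n ⊕ Fin m) ℂ}
    (hc : IsGeodesic n m c) : IsProjGeodesic c (velocity c) (velocity (velocity c)) := by
  have hI := uniqueDiffOn_Icc (zero_lt_one (α := ℝ))
  have hv : ∀ i j, ContDiffOn ℝ 1 (fun t => velocity c t i j) (Icc 0 1) := fun i j =>
    (hc.smooth i j).derivWithin hI (by norm_num [one_add_one_eq_two])
  have hp : IsProjCurve c (velocity c) :=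
    { herm := fun s hs => (hc.mem s hs).1
      idem := fun s hs => (hc.mem s hs).2.1
      deriv := fun s hs => hasDerivWithinAt_velocity fun i j =>
        (hc.smooth i j).differentiableOn two_ne_zero s hs
      cont := continuousOn_iff_entries.2 fun i j => (hv i j).continuousOn }
  have hd₂ : ∀ s ∈ Icc (0 : ℝ) 1,
      HasDerivWithinAt (velocity c) (velocity (velocity c) s) (Icc 0 1) s := fun s hs =>
    hasDerivWithinAt_velocity fun i j => (hv i j).differentiableOn one_ne_zero s hs
  refine { hp with deriv₂ := hd₂, normal := fun s hs => ?_ }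
  refine mul_mul_eq_of_trace_eq_zero (hp.herm s hs) (hp.idem s hs) ?_
    fun X hX hX' => hc.accel s hs X ⟨hX, hX'⟩
  have h1 := hasDerivWithinAt_congr (B := velocity c)
    (hasDerivWithinAt_conjTranspose (hd₂ s hs)) (fun τ hτ => (hp.deriv_herm hτ).symm) hs
  exact hasDerivWithinAt_unique hs h1 (hd₂ s hs)

/-- The C² assumption supplies the continuous mixed derivative; passing through `fderivWithin` on
the square gives joint continuity of the partial velocities. -/
theorem IsTriangleSurface.isProjSurface {n m : ℕ} {Z Z' : Matrix (Fin n) (Fin m) ℂ}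
    {σ : ℝ → ℝ → Matrix (Fin n ⊕ Fin m) (Fin n ⊕ Fin m) ℂ} (hσ : IsTriangleSurface Z Z' σ) :
    IsProjSurface σ (fun s t => velocity (fun s' => σ s' t) s)
      (fun s t => velocity (fun t' => σ s t') t)
      (fun s => velocity fun t => velocity (fun s' => σ s' t) s) := by
  have hI := uniqueDiffOn_Icc (zero_lt_one (α := ℝ))
  set S : Set (ℝ × ℝ) := Icc 0 1 ×ˢ Icc 0 1 with hS
  set A : Fin n ⊕ Fin m → Fin n ⊕ Fin m → ℝ × ℝ → ℂ := fun i j p =>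
    fderivWithin ℝ (fun p : ℝ × ℝ => σ p.1 p.2 i j) S p (1, 0) with hA
  have hfst : ∀ i j, ∀ s ∈ Icc (0 : ℝ) 1, ∀ t ∈ Icc (0 : ℝ) 1, HasDerivWithinAt
      (fun s => σ s t i j) (A i j (s, t)) (Icc 0 1) s := fun i j s hs t ht =>
    hasDerivWithinAt_fst_of_contDiffOn two_ne_zero (hσ.smooth i j) hs ht
  have hsnd := fun i j s hs t ht =>
    hasDerivWithinAt_snd_of_contDiffOn (s := s) (t := t) two_ne_zero (hσ.smooth i j) hs ht
  have hAc : ∀ i j, ContDiffOn ℝ 1 (A i j) S := fun i j =>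
    contDiffOn_fderivWithin_square (hσ.smooth i j) (by norm_num [one_add_one_eq_two]) _
  have hAe : ∀ i j, ∀ s ∈ Icc (0 : ℝ) 1, ∀ t ∈ Icc (0 : ℝ) 1,
      velocity (fun s' => σ s' t) s i j = A i j (s, t) := fun i j s hs t ht =>
    (hfst i j s hs t ht).derivWithin (hI s hs)
  have hmix : ∀ i j, ∀ s ∈ Icc (0 : ℝ) 1, ∀ t ∈ Icc (0 : ℝ) 1, HasDerivWithinAt
      (fun t => velocity (fun s' => σ s' t) s i j)
      (fderivWithin ℝ (A i j) S (s, t) (0, 1)) (Icc 0 1) t := fun i j s hs t ht =>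
    (hasDerivWithinAt_snd_of_contDiffOn one_ne_zero (hAc i j) hs ht).congr_of_mem
      (fun τ hτ => hAe i j s hs τ hτ) ht
  refine ⟨fun s hs t ht => (hσ.mem s hs t ht).1, fun s hs t ht => (hσ.mem s hs t ht).2.1,
    fun s hs t ht => hasDerivWithinAt_velocity fun i j =>
      (hfst i j s hs t ht).differentiableWithinAt,
    fun s hs t ht => hasDerivWithinAt_velocity fun i j =>
      (hsnd i j s hs t ht).differentiableWithinAt,
    fun s hs t ht => hasDerivWithinAt_velocity fun i j =>
      (hmix i j s hs t ht).differentiableWithinAt,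
    continuousOn_iff_entries.2 fun i j => (hAc i j).continuousOn.congr
      fun p hp => hAe i j p.1 hp.1 p.2 hp.2,
    continuousOn_iff_entries.2 fun i j => ?_, continuousOn_iff_entries.2 fun i j => ?_⟩
  · exact (contDiffOn_fderivWithin_square (l := 1) (hσ.smooth i j)
      (by norm_num [one_add_one_eq_two]) (0, 1)).continuousOn.congr
      fun p hp => (hsnd i j p.1 hp.1 p.2 hp.2).derivWithin (hI p.2 hp.2)
  · exact (contDiffOn_fderivWithin_square (l := 0) (hAc i j) (by norm_num) (0, 1)).continuousOn.congr
      fun p hp => (hmix i j p.1 hp.1 p.2 hp.2).derivWithin (hI p.2 hp.2)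

end CGrass

end

/-! ### Continuous logarithms and arguments -/

noncomputable section

open Set Filter Topology MeasureTheory

open Matrix

/-- The real part vanishes, and the imaginary part is a continuous lift of a constant through the
covering ℝ → circle, hence constant. -/
theorem eq_zero_of_cexp_eq_one {d : ℝ → ℂ} (hd : ContinuousOn d (Icc 0 1))
    (h : ∀ t ∈ Icc (0 : ℝ) 1, Complex.exp (d t) = 1) (h0 : d 0 = 0) {t : ℝ}
    (ht : t ∈ Icc (0 : ℝ) 1) : d t = 0 := by
  have hre : ∀ t ∈ Icc (0 : ℝ) 1, (d t).re = 0 := fun t ht => by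
    obtain ⟨k, hk⟩ := Complex.exp_eq_one_iff.1 (h t ht)
    simp [hk]
  have him : ∀ t ∈ Icc (0 : ℝ) 1, Circle.exp (d t).im = 1 := fun t ht => by
    refine Circle.ext ?_
    have e : ((d t).im : ℂ) * Complex.I = d t := by
      apply Complex.ext <;> simp [hre t ht]
    rw [Circle.coe_exp, e, h t ht, Circle.coe_one]
  have hc : Continuous fun t : Icc (0 : ℝ) 1 => (d t).im :=
    Complex.continuous_im.comp (continuousOn_iff_continuous_domRestrict.1 hd)
  have := Circle.isCoveringMap_exp.const_of_comp hc
    (fun a b => by rw [him a a.2, him b b.2]) ⟨t, ht⟩ ⟨0, by simp⟩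
  simp only [h0, Complex.zero_im] at this
  exact Complex.ext (hre t ht) this

/-- Equality on the complement of the zeros of an analytic function extends by continuity. -/
theorem cexp_eq_one_of_analytic {d f : ℝ → ℂ} (hd : ContinuousOn d (Icc 0 1))
    (hf : AnalyticOnNhd ℝ f univ) (hf0 : f 0 ≠ 0)
    (h : ∀ t ∈ Icc (0 : ℝ) 1, f t ≠ 0 → Complex.exp (d t) = 1) {t : ℝ}
    (ht : t ∈ Icc (0 : ℝ) 1) : Complex.exp (d t) = 1 := by
  have hne : ∀ᶠ z in 𝓝[≠] t, f z ≠ 0 := by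
    refine (hf t (mem_univ t)).eventually_eq_zero_or_eventually_ne_zero.resolve_left fun h0 => ?_
    exact hf0 (hf.eqOn_zero_of_preconnected_of_eventuallyEq_zero isPreconnected_univ
      (mem_univ t) h0 (mem_univ 0))
  have hacc : (𝓝[Icc 0 1 \ {t}] t).NeBot := by
    have := (uniqueDiffOn_Icc (zero_lt_one (α := ℝ)) t ht).accPt
    rwa [accPt_principal_iff_nhdsWithin] at this
  have h1 : Tendsto (fun z => Complex.exp (d z)) (𝓝[Icc 0 1 \ {t}] t) (𝓝 (Complex.exp (d t))) :=
    ((hd t ht).cexp).tendsto.mono_left (nhdsWithin_mono _ sdiff_subset)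
  have h2 : ∀ᶠ z in 𝓝[Icc 0 1 \ {t}] t, Complex.exp (d z) = 1 := by
    have h3 : ∀ᶠ z in 𝓝[Icc 0 1 \ {t}] t, f z ≠ 0 :=
      hne.filter_mono (nhdsWithin_mono _ fun z hz => hz.2)
    filter_upwards [h3, self_mem_nhdsWithin] with z hz hz' using h z hz'.1 hz
  exact tendsto_nhds_unique (h1.congr' h2) tendsto_const_nhds

/-- A nowhere vanishing function on the square that is real on the edges `s = 0`, `t = 0`, `t = 1`
has a continuous choice of twice its argument on the edge `s = 1` that vanishes at both ends. -/
theorem exists_continuous_angle {a : ℝ → ℝ → ℂ}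
    (ha : ContinuousOn (Function.uncurry a) (Icc 0 1 ×ˢ Icc 0 1))
    (hne : ∀ s ∈ Icc (0 : ℝ) 1, ∀ t ∈ Icc (0 : ℝ) 1, a s t ≠ 0)
    (h0 : ∀ t ∈ Icc (0 : ℝ) 1, star (a 0 t) = a 0 t)
    (hs0 : ∀ s ∈ Icc (0 : ℝ) 1, star (a s 0) = a s 0)
    (hs1 : ∀ s ∈ Icc (0 : ℝ) 1, star (a s 1) = a s 1) :
    ∃ φ : ℝ → ℝ, ContinuousOn φ (Icc 0 1) ∧ φ 0 = 0 ∧ φ 1 = 0 ∧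
      ∀ t ∈ Icc (0 : ℝ) 1, Complex.exp (-(φ t * Complex.I)) * star (a 1 t) = a 1 t := by
  have hac : Continuous fun p : unitInterval × unitInterval => a p.1 p.2 :=
    ha.comp_continuous (f := fun p : unitInterval × unitInterval => ((p.1 : ℝ), (p.2 : ℝ)))
      (by fun_prop) fun p => ⟨p.1.2, p.2.2⟩
  -- H is ā/a, equal to 1 wherever a is real.
  let H : C(unitInterval × unitInterval, Circle) :=
    ⟨fun p => Circle.ofConjDivSelf (a p.1 p.2) (hne _ p.1.2 _ p.2.2),
      Continuous.subtype_mk ((continuous_star.comp hac).div hac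
        fun p => hne _ p.1.2 _ p.2.2) _⟩
  have hH1 : ∀ p : unitInterval × unitInterval, star (a p.1 p.2) = a p.1 p.2 → H p = 1 := by
    intro p hp
    refine Circle.ext ?_
    change star (a p.1 p.2) / a p.1 p.2 = 1
    rw [hp, div_self (hne _ p.1.2 _ p.2.2)]
  let φ := Circle.isCoveringMap_exp.liftHomotopy H (ContinuousMap.const _ 0) fun t => by
    rw [hH1 _ (h0 t t.2)]; simp
  have hφ : ∀ p, Circle.exp (φ p) = H p := fun p =>
    congrFun (Circle.isCoveringMap_exp.liftHomotopy_lifts H (ContinuousMap.const _ 0) _) p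
  have hφ0 : ∀ t, φ (0, t) = 0 := fun t =>
    Circle.isCoveringMap_exp.liftHomotopy_zero H (ContinuousMap.const _ 0) _ t
  -- On the edges t = 0 and t = 1 the lift covers the constant 1, so it keeps its value 0 from s =
  -- 0.
  have hedge : ∀ t : unitInterval, (∀ s : unitInterval, H (s, t) = 1) → φ (1, t) = 0 := by
    intro t ht
    rw [← hφ0 t]
    exact Circle.isCoveringMap_exp.const_of_comp (g := fun s : unitInterval => φ (s, t))
      (by fun_prop) (fun s s' => by rw [hφ, hφ, ht, ht]) 1 0
  refine ⟨fun t => φ (1, projIcc 0 1 zero_le_one t), ?_, ?_, ?_, fun t ht => ?_⟩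
  · exact (φ.continuous.comp (continuous_const.prodMk continuous_projIcc)).continuousOn
  · simp only [projIcc_left]
    exact hedge _ fun s => hH1 _ (hs0 s s.2)
  · simp only [projIcc_right]
    exact hedge _ fun s => hH1 _ (hs1 s s.2)
  · have e := congrArg Subtype.val (hφ (1, projIcc 0 1 zero_le_one t))
    have e' : Complex.exp ((φ (1, projIcc 0 1 zero_le_one t) : ℝ) * Complex.I)
        = star (a 1 t) / a 1 t := by
      rw [projIcc_of_mem zero_le_one ht] at e ⊢
      exact e
    have hn : a 1 t ≠ 0 := hne 1 (by simp) t ht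
    rw [Complex.exp_neg, e', inv_div, div_mul_cancel₀]
    exact star_ne_zero.2 hn

/-! ### Orthonormal frames and Pontrjagin coordinates -/

namespace CGrass

variable {n m : ℕ}

theorem frame_zero_mul_conjTranspose :
    frame (0 : Matrix (Fin n) (Fin m) ℂ) * (frame (0 : Matrix (Fin n) (Fin m) ℂ))ᴴ = 1 := by
  simp [frame_mul_frame]

theorem point_zero : point (0 : Matrix (Fin n) (Fin m) ℂ)
    = (frame (0 : Matrix (Fin n) (Fin m) ℂ))ᴴ * frame (0 : Matrix (Fin n) (Fin m) ℂ) := by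
  rw [point, frame_zero_mul_conjTranspose, inv_one, Matrix.mul_one]

theorem mul_frame_zero_conjTranspose (U : Matrix (Fin n) (Fin n ⊕ Fin m) ℂ) :
    U * (frame (0 : Matrix (Fin n) (Fin m) ℂ))ᴴ = U.toCols₁ := by
  ext i j
  simp [Matrix.mul_apply, frame, Matrix.one_apply]

theorem frame_eq_mul {U : Matrix (Fin n) (Fin n ⊕ Fin m) ℂ} {W : Matrix (Fin n) (Fin m) ℂ}
    (h : Uᴴ * U = point W) : frame W * Uᴴ * U = frame W := by
  rw [Matrix.mul_assoc, h, frame_mul_point]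

/-- The factor frame W · U⁺ changes the orthonormal frame into (1|W); reading off the first n
columns shows that the two matrices are inverse to each other. -/
theorem det_frame_mul_det {U : Matrix (Fin n) (Fin n ⊕ Fin m) ℂ} {W : Matrix (Fin n) (Fin m) ℂ}
    (h : Uᴴ * U = point W) :
    (frame W * Uᴴ).det * (U * (frame (0 : Matrix (Fin n) (Fin m) ℂ))ᴴ).det = 1 := by
  rw [← det_mul, ← Matrix.mul_assoc, frame_eq_mul h, frame_mul_frame]
  simp

/-- `det (1 + Z W⁺)` in terms of orthonormal frames `U₀`, `U` of the subspaces with coordinates `Z`,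
`W` and of another orthonormal frame `V` of the latter. -/
theorem det_one_add_mul {U₀ U V : Matrix (Fin n) (Fin n ⊕ Fin m) ℂ}
    {Z W : Matrix (Fin n) (Fin m) ℂ} (h₀ : U₀ᴴ * U₀ = point Z) (h : Uᴴ * U = point W)
    (hU : U * Uᴴ = 1) (hV : Vᴴ * V = Uᴴ * U) :
    (1 + Z * Wᴴ).det = (frame Z * U₀ᴴ).det * star (V * U₀ᴴ).det * (V * Uᴴ).det
      * star (frame W * Uᴴ).det := by
  rw [← det_conjTranspose, ← det_conjTranspose, ← det_mul, ← det_mul, ← det_mul,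
    ← frame_mul_frame]
  congr 1
  have e : Vᴴ * (V * Uᴴ) = Uᴴ := by
    rw [← Matrix.mul_assoc, hV, Matrix.mul_assoc, hU, Matrix.mul_one]
  calc frame Z * (frame W)ᴴ = (frame Z * U₀ᴴ * U₀) * (frame W * Uᴴ * U)ᴴ := by
        rw [frame_eq_mul h₀, frame_eq_mul h]
    _ = frame Z * U₀ᴴ * (U₀ * Uᴴ) * (frame W * Uᴴ)ᴴ := by
        simp only [conjTranspose_mul, Matrix.mul_assoc]
    _ = frame Z * U₀ᴴ * (U₀ * (Vᴴ * (V * Uᴴ))) * (frame W * Uᴴ)ᴴ := by rw [e]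
    _ = _ := by simp only [conjTranspose_mul, conjTranspose_conjTranspose, Matrix.mul_assoc]

/-- When the first block a of V is invertible, a⁻¹V has the form (1|W) and spans the same subspace.
-/
theorem exists_eq_point {V : Matrix (Fin n) (Fin n ⊕ Fin m) ℂ} (hV : V * Vᴴ = 1)
    (h : (V * (frame (0 : Matrix (Fin n) (Fin m) ℂ))ᴴ).det ≠ 0) :
    ∃ W : Matrix (Fin n) (Fin m) ℂ, Vᴴ * V = point W := by
  rw [mul_frame_zero_conjTranspose] at h
  set a := V.toCols₁ with ha
  have hu : IsUnit a.det := h.isUnit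
  have hF : frame (a⁻¹ * V.toCols₂) = a⁻¹ * V := by
    conv_rhs => rw [← fromCols_toCols V, mul_fromCols, ← ha, nonsing_inv_mul _ hu]
    rfl
  refine ⟨a⁻¹ * V.toCols₂, ?_⟩
  have hinv : (a⁻¹ * (a⁻¹)ᴴ)⁻¹ = aᴴ * a := by
    rw [Matrix.mul_inv_rev, nonsing_inv_nonsing_inv _ hu, ← conjTranspose_nonsing_inv,
      nonsing_inv_nonsing_inv _ hu]
  rw [point, hF, conjTranspose_mul, Matrix.mul_assoc a⁻¹, ← Matrix.mul_assoc V, hV,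
    Matrix.one_mul, hinv]
  have e1 : (a⁻¹)ᴴ * aᴴ = 1 := by
    rw [← conjTranspose_mul, mul_nonsing_inv _ hu, conjTranspose_one]
  calc Vᴴ * V = Vᴴ * ((a⁻¹)ᴴ * aᴴ) * (a * a⁻¹) * V := by
        rw [e1, mul_nonsing_inv _ hu, Matrix.mul_one, Matrix.mul_one]
    _ = _ := by simp only [Matrix.mul_assoc]

end CGrass

end

/-! ### The area as a branch of the logarithm -/

noncomputable section

open Set Filter Topology MeasureTheory

open Matrix

namespace CGrass

variable {n m : ℕ}

/-- The area of a triangle surface through continuous data on its side `zz'`: `β` is four times `i`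
times the area swept out, `a` compares the radially parallel frame with the Pontrjagin one, and `f`
vanishes where the branch of the logarithm is not determined pointwise. -/
theorem IsTriangleSurface.exists_area_data {Z Z' : Matrix (Fin n) (Fin m) ℂ}
    {σ : ℝ → ℝ → Matrix (Fin n ⊕ Fin m) (Fin n ⊕ Fin m) ℂ} (hσ : IsTriangleSurface Z Z' σ) :
    ∃ (β : ℝ → ℂ) (a : ℝ → ℝ → ℂ) (f : ℝ → ℂ),
      ContinuousOn β (Icc 0 1) ∧ β 0 = 0 ∧ β 1 = 4 * Complex.I * symplecticArea σ ∧
      ContinuousOn (Function.uncurry a) (Icc 0 1 ×ˢ Icc 0 1) ∧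
      (∀ t ∈ Icc (0 : ℝ) 1, a 0 t = 1) ∧
      (∀ t ∈ Icc (0 : ℝ) 1, IsGeodesic n m (fun s => σ s t) →
        ∀ s ∈ Icc (0 : ℝ) 1, star (a s t) = a s t) ∧
      (∀ s ∈ Icc (0 : ℝ) 1, ∀ t ∈ Icc (0 : ℝ) 1, σ s t ∈ V0 n m → a s t ≠ 0) ∧
      (∀ t ∈ Icc (0 : ℝ) 1, ∀ W : Matrix (Fin n) (Fin m) ℂ, σ 1 t = point W →
        ∀ x : ℂ, x * star (a 1 t) = a 1 t →
          Complex.exp (β t) * x * (1 + W * Zᴴ).det = (1 + Z * Wᴴ).det) ∧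
      AnalyticOnNhd ℝ f univ ∧ f 0 ≠ 0 ∧
      (∀ t ∈ Icc (0 : ℝ) 1, f t ≠ 0 →
        ∃ W : Matrix (Fin n) (Fin m) ℂ, σ 1 t = point W ∧ (1 + W * Zᴴ).det ≠ 0) := by
  have hS := hσ.isProjSurface
  have h01 : (0 : ℝ) ∈ Icc (0 : ℝ) 1 := by simp
  have h11 : (1 : ℝ) ∈ Icc (0 : ℝ) 1 := by simp
  set E : Matrix (Fin n) (Fin n ⊕ Fin m) ℂ := frame 0 with hE
  have hEE : E * Eᴴ = 1 := frame_zero_mul_conjTranspose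
  obtain ⟨U, T, hU0, hpar, hUd, hUc, hTc, harea⟩ := hS.exists_radial_frame hEE
    fun t ht => by rw [hσ.apex t ht, point_zero]
  have hUU : ∀ s ∈ Icc (0 : ℝ) 1, ∀ t ∈ Icc (0 : ℝ) 1, U s t * (U s t)ᴴ = 1 :=
    fun s hs t ht => (hpar t ht).orth s hs
  have hUP : ∀ s ∈ Icc (0 : ℝ) 1, ∀ t ∈ Icc (0 : ℝ) 1, (U s t)ᴴ * U s t = σ s t :=
    fun s hs t ht => (hpar t ht).proj s hs
  have hbase := hσ.base.isProjGeodesic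
  obtain ⟨V, hV0, hV⟩ := hbase.toIsProjCurve.exists_isParallelFrame
    (V₀ := U 1 0) (hUU 1 h11 0 h01) (hUP 1 h11 0 h01)
  have hT1 : ContinuousOn (T 1) (Icc 0 1) :=
    hTc.comp (f := fun t : ℝ => ((1 : ℝ), t)) (by fun_prop) fun _ ht => ⟨h11, ht⟩
  have hU1 : ContinuousOn (U 1) (Icc 0 1) := continuousOn_of_hasDerivWithinAt (hUd 1 h11)
  set α : ℝ → ℂ := fun t => (T 1 t * (U 1 t)ᴴ).trace with hα
  have hαc : ContinuousOn α (Icc 0 1) :=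
    continuousOn_trace (continuousOn_matMul hT1 (continuousOn_conjTranspose hU1))
  -- The connection form of an orthonormal frame is skew-Hermitian, so its trace is imaginary.
  have hαim : ∀ t ∈ Icc (0 : ℝ) 1, (α t).re = 0 := by
    intro t ht
    have h1 := congrArg trace (deriv_mul_conjTranspose_add (hUd 1 h11) (hUU 1 h11) ht)
    have h2 : (U 1 t * (T 1 t)ᴴ).trace = star (α t) := by
      rw [hα, ← trace_conjTranspose, conjTranspose_mul, conjTranspose_conjTranspose]
    rw [trace_add, h2, trace_zero] at h1
    have := congrArg Complex.re h1
    simp only [Complex.add_re, Complex.star_def, Complex.conj_re, Complex.zero_re] at this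
    linarith
  have hαeq : ∀ t ∈ Icc (0 : ℝ) 1, α t = Complex.I * ((α t).im : ℝ) := fun t ht => by
    apply Complex.ext <;> simp [hαim t ht]
  have hint : ∀ t ∈ Icc (0 : ℝ) 1,
      ∫ τ in (0 : ℝ)..t, α τ = Complex.I * ((∫ τ in (0 : ℝ)..t, (α τ).im : ℝ) : ℂ) := by
    intro t ht
    rw [← intervalIntegral.integral_ofReal, ← intervalIntegral.integral_const_mul]
    refine intervalIntegral.integral_congr fun τ hτ => hαeq τ ?_
    rw [uIcc_of_le ht.1] at hτ
    exact ⟨hτ.1, hτ.2.trans ht.2⟩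
  have hdetU : ∀ t ∈ Icc (0 : ℝ) 1,
      (V t * (U 1 t)ᴴ).det = Complex.exp (-∫ τ in (0 : ℝ)..t, α τ) := fun t ht =>
    IsParallelFrame.det_mul_conjTranspose hbase.toIsProjCurve hV (hUd 1 h11) hT1 (hUU 1 h11)
      (hUP 1 h11) hV0 ht
  have harea' : symplecticArea σ = -(1 / 2) * ∫ t in (0 : ℝ)..1, (α t).im := by
    rw [symplecticArea, ← intervalIntegral.integral_const_mul]
    refine intervalIntegral.integral_congr fun t ht => ?_
    rw [uIcc_of_le zero_le_one] at ht
    refine (harea t ht).trans ?_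
    change (Complex.I / 2 * α t).re = _
    rw [hαeq t ht]
    simp
  obtain ⟨f₁, hf₁, hf₁e⟩ := hbase.det_frame_mul_analytic hV (V 0)ᴴ
  obtain ⟨f₂, hf₂, hf₂e⟩ := hbase.det_frame_mul_analytic hV Eᴴ
  have hane : ∀ s ∈ Icc (0 : ℝ) 1, ∀ t ∈ Icc (0 : ℝ) 1, σ s t ∈ V0 n m →
      (U s t * Eᴴ).det ≠ 0 := by
    rintro s hs t ht ⟨W, hW⟩
    exact right_ne_zero_of_mul_eq_one (det_frame_mul_det ((hUP s hs t ht).trans hW.symm))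
  -- The frame starts at E, so this is the Gram determinant of a parallel frame along a geodesic
  -- with its initial value.
  have hreal : ∀ t ∈ Icc (0 : ℝ) 1, IsGeodesic n m (fun s => σ s t) →
      ∀ s ∈ Icc (0 : ℝ) 1, star (U s t * Eᴴ).det = (U s t * Eᴴ).det := by
    intro t ht hg s hs
    obtain ⟨r, hr⟩ := hg.isProjGeodesic.det_frame_mul_frame_zero (hpar t ht) hs
    rw [hU0 t ht] at hr
    rw [hr]
    exact Complex.conj_ofReal r
  have hZ : (V 0)ᴴ * V 0 = point Z := by rw [hV0, hUP 1 h11 0 h01, hσ.vertex]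
  have hstar : ∀ W : Matrix (Fin n) (Fin m) ℂ, (1 + W * Zᴴ).det = star (1 + Z * Wᴴ).det := by
    intro W
    rw [← det_conjTranspose]
    simp
  -- In the product f, the first factor detects the nonvanishing of det(1+WZ⁺), and the second the
  -- existence of the coordinate W.
  refine ⟨fun t => -2 * ∫ τ in (0 : ℝ)..t, α τ, fun s t => (U s t * Eᴴ).det,
    fun t => f₁ t * f₂ t, ?_, by simp, ?_, ?_, fun t ht => ?_, hreal, hane,
    fun t ht W hW x hx => ?_, hf₁.mul hf₂, ?_, fun t ht hft => ?_⟩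
  · exact continuousOn_const.mul fun t ht =>
      (hasDerivWithinAt_integral_of_continuousOn hαc ht).continuousWithinAt
  · simp only
    rw [hint 1 h11, harea']
    push_cast
    ring
  · exact continuousOn_det (continuousOn_matMul hUc continuousOn_const)
  · simp only [hU0 t ht, hEE, det_one]
  · have hW' : (U 1 t)ᴴ * U 1 t = point W := (hUP 1 h11 t ht).trans hW
    have hformula := det_one_add_mul hZ hW' (hUU 1 h11 t ht)
      ((hV.proj t ht).trans (hUP 1 h11 t ht).symm)
    obtain ⟨r, hr⟩ := hbase.det_frame_mul_frame_zero hV ht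
    have hone := det_frame_mul_det hW'
    have hZone := det_frame_mul_det hZ
    have hZreal : star (frame Z * (V 0)ᴴ).det = (frame Z * (V 0)ᴴ).det := by
      have h1 := hreal 0 h01 hσ.side 1 h11
      rw [← hV0] at h1
      have h2 := congrArg star hZone
      rw [star_mul', ← hE, h1, star_one] at h2
      exact mul_right_cancel₀ (right_ne_zero_of_mul_eq_one hZone) (h2.trans hZone.symm)
    set I₁ := ∫ τ in (0 : ℝ)..t, α τ with hI₁
    have hDstar : star (Complex.exp (-I₁)) = Complex.exp I₁ := by
      rw [Complex.star_def, ← Complex.exp_conj, hI₁, hint t ht]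
      simp
    rw [hdetU t ht, hr] at hformula
    rw [hstar, hformula]
    simp only [star_mul', star_star]
    rw [hDstar, hZreal]
    have hr' : star ((r : ℝ) : ℂ) = r := Complex.conj_ofReal r
    rw [hr']
    set hw := (frame W * (U 1 t)ᴴ).det with hhw
    -- `hw` is the inverse of a(1,t), so the condition x·ā = a becomes this relation.
    have hx' : x * hw = star hw := by
      have h2 := congrArg star hone
      rw [star_mul', star_one] at h2
      change x * star (U 1 t * Eᴴ).det = (U 1 t * Eᴴ).det at hx
      rw [← hE] at h2 hone
      linear_combination (-x * hw) * h2 + hw * star hw * hx + star hw * hone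
    have hexp : Complex.exp (-2 * I₁) * Complex.exp I₁ = Complex.exp (-I₁) := by
      rw [← Complex.exp_add]; congr 1; ring
    linear_combination ((frame Z * (V 0)ᴴ).det * r) * (x * hw * hexp + Complex.exp (-I₁) * hx')
  · simp only
    rw [← hf₁e 0 h01, ← hf₂e 0 h01, hV.orth 0 h01, det_one, one_mul]
    exact right_ne_zero_of_mul_eq_one (det_frame_mul_det hZ)
  · simp only at hft
    rw [← hf₁e t ht, ← hf₂e t ht] at hft
    obtain ⟨W, hW⟩ := exists_eq_point (hV.orth t ht) (right_ne_zero_of_mul hft)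
    refine ⟨W, (hV.proj t ht).symm.trans hW, ?_⟩
    -- V serves here as both frames of the running point, so the comparison factor is 1.
    rw [hstar, det_one_add_mul hZ hW (hV.orth t ht) rfl, hV.orth t ht, det_one]
    have h1 := left_ne_zero_of_mul_eq_one (det_frame_mul_det hZ)
    have h2 := left_ne_zero_of_mul_eq_one (det_frame_mul_det hW)
    have h3 := left_ne_zero_of_mul hft
    simp only [ne_eq, star_eq_zero, mul_eq_zero, one_ne_zero, not_or]
    exact ⟨⟨⟨h1, h3⟩, not_false⟩, h2⟩

theorem IsLogBranch.eqOn {Z : Matrix (Fin n) (Fin m) ℂ}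
    {c : ℝ → Matrix (Fin n ⊕ Fin m) (Fin n ⊕ Fin m) ℂ} {L L' : ℝ → ℂ}
    (hL : IsLogBranch Z c L) (hL' : IsLogBranch Z c L') {f : ℝ → ℂ}
    (hf : AnalyticOnNhd ℝ f univ) (hf0 : f 0 ≠ 0)
    (h : ∀ t ∈ Icc (0 : ℝ) 1, f t ≠ 0 →
      ∃ W : Matrix (Fin n) (Fin m) ℂ, c t = point W ∧ (1 + W * Zᴴ).det ≠ 0) :
    EqOn L L' (Icc 0 1) := by
  intro t ht
  have hd : ContinuousOn (fun t => L t - L' t) (Icc 0 1) := hL.cont.sub hL'.cont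
  refine sub_eq_zero.1 (eq_zero_of_cexp_eq_one hd (fun t ht =>
    cexp_eq_one_of_analytic hd hf hf0 (fun t ht hft => ?_) ht) (by simp [hL.zero, hL'.zero]) ht)
  obtain ⟨W, hW, hne⟩ := h t ht hft
  have e : Complex.exp (L t) = Complex.exp (L' t) :=
    mul_right_cancel₀ hne ((hL.exp_eq t ht W hW).trans (hL'.exp_eq t ht W hW).symm)
  rw [Complex.exp_sub, e, div_self (Complex.exp_ne_zero _)]

end CGrass

end

theorem theorem4 (n m : ℕ) (Z Z' : Matrix (Fin n) (Fin m) ℂ)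
    (σ : ℝ → ℝ → Matrix (Fin n ⊕ Fin m) (Fin n ⊕ Fin m) ℂ)
    (hσ : CGrass.IsTriangleSurface Z Z' σ) :
    Complex.exp (4 * Complex.I * (CGrass.symplecticArea σ : ℂ)) * (1 + Z' * Zᴴ).det
        = (1 + Z * Z'ᴴ).det ∧
    ((∀ t ∈ Set.Icc (0 : ℝ) 1, CGrass.IsGeodesic n m (fun s => σ s t)) ∨
        (∀ s ∈ Set.Icc (0 : ℝ) 1, ∀ t ∈ Set.Icc (0 : ℝ) 1, σ s t ∈ CGrass.V0 n m) →
      (∃ L : ℝ → ℂ, CGrass.IsLogBranch Z (fun t => σ 1 t) L) ∧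
      ∀ L : ℝ → ℂ, CGrass.IsLogBranch Z (fun t => σ 1 t) L →
        (CGrass.symplecticArea σ : ℂ) = 1 / (4 * Complex.I) * L 1) := by
  obtain ⟨β, a, f, hβc, hβ0, hβ1, hac, ha0, hareal, hane, hβ, hf, hf0, hfW⟩ :=
    hσ.exists_area_data
  have h01 : (0 : ℝ) ∈ Set.Icc (0 : ℝ) 1 := by simp
  have h11 : (1 : ℝ) ∈ Set.Icc (0 : ℝ) 1 := by simp
  refine ⟨?_, fun hcase => ?_⟩
  -- Here x = 1, because the edge t = 1 is a geodesic and a is real on it.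
  · have h := hβ 1 h11 Z' hσ.vertex' 1 (by rw [one_mul, hareal 1 h11 hσ.side' 1 h11])
    rwa [mul_one, hβ1] at h
  have key : ∃ L : ℝ → ℂ, CGrass.IsLogBranch Z (fun t => σ 1 t) L ∧ L 1 = β 1 := by
    rcases hcase with hgeo | hV0
    · refine ⟨β, ⟨hβc, hβ0, fun t ht W hW => ?_⟩, rfl⟩
      have h := hβ t ht W hW 1 (by rw [one_mul, hareal t ht (hgeo t ht) 1 h11])
      rwa [mul_one] at h
    · obtain ⟨φ, hφc, hφ0, hφ1, hφ⟩ := exists_continuous_angle hac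
        (fun s hs t ht => hane s hs t ht (hV0 s hs t ht))
        (fun t ht => by rw [ha0 t ht, star_one]) (hareal 0 h01 hσ.side) (hareal 1 h11 hσ.side')
      -- The angle φ corrects the phase of a along the side and vanishes at t = 1, so the final
      -- value is still that of β.
      refine ⟨fun t => β t + -(φ t * Complex.I), ⟨?_, by simp [hβ0, hφ0], fun t ht W hW => ?_⟩,
        by simp [hφ1]⟩
      · exact hβc.add
          ((Complex.continuous_ofReal.comp_continuousOn hφc).mul continuousOn_const).neg
      · rw [Complex.exp_add]
        exact hβ t ht W hW _ (hφ t ht)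
  obtain ⟨L₀, hL₀, hL₀1⟩ := key
  refine ⟨⟨L₀, hL₀⟩, fun L hL => ?_⟩
  rw [hL.eqOn hL₀ hf hf0 hfW h11, hL₀1, hβ1]
  field_simp [Complex.I_ne_zero]
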